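/- Let $r\ge 2$ and $d\ge 1$ be integers, let $a_0,\dots,a_r\in\mathbb Z$, and let $m_0,\dots,m_r$ and $p_0,\dots,p_r$ be positive integers. Put $\omega=(p_0,\dots,p_r)$ and let $\mu_d$ be the group of complex $d$th roots of unity. Let $X(d;a)=\mathbb C^{r+1}/\mu_d$ for the action $\xi\cdot(x_0,\dots,x_r)=(\xi^{a_0}x_0,\dots,\xi^{a_r}x_r)$. Let $\mathbb P^r_\omega=(\mathbb C^{r+1}\setminus\{0\})/\mathbb C^*$ for the action $t\cdot u=(t^{p_0}u_0,\dots,t^{p_r}u_r)$. The $\omega$-weighted blow-up of $X(d;a)$ at the origin is $$\pi:\ \hat X=\{(x,[u])\in\mathbb C^{r+1}\times\mathbb P^r_\omega \mid x\in\overline{\mathbb C^*\cdot u}\}/\mu_d\longrightarrow X(d;a),\qquad [(x,[u])]\mapsto[x],$$ where $\mu_d$ acts on both factors by $\xi\cdot(x,[u])=(\xi\cdot x,[\xi\cdot u])$. Its exceptional divisor $\pi^{-1}(0)$ is identified with $\mathbb P^r_\omega(d;a):=\mathbb P^r_\omega/\mu_d$. All topological notions below refer to the Zariski topology. Assume that $d\mid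 a_im_i$ for $i=0,\dots,r$, that $a_ip_j-a_jp_i=0$ for all $i,j\in\{1,\dots,r\}$, and that each of the polynomials $$x_0^{m_0}+x_1^{m_1}+x_2^{m_2},\qquad x_i^{m_i}+x_{i+1}^{m_{i+1}}\quad(2\le i\le r-1)$$ is weighted homogeneous with respect to $\omega$. Let $\mathcal E\subset\mathbb P^r_\omega(d;a)=\pi^{-1}(0)$ be the common zero set of these polynomials, and assume that there is one point $A$ with $\mathcal E\cap\{x_i=0\}=\{A\}$ for all $i=2,\dots,r$. Let $D\subset X(d;a)$ be defined by $$x_0^{m_0}=0,\qquad x_i^{m_i}+x_{i+1}^{m_{i+1}}=0\quad(1\le i\le r-1),$$ and let $\mathcal D=\overline{\pi^{-1}(D\setminus\{0\})}\subset\hat X$ be its strict transform. Then: (i) $\mathcal D$ has exactly $\dfrac{m_1\cdots m_r}{\operatorname{lcm}(m_1,\dots,m_r)}$ irreducible components, and they are pairwise disjoint; (ii) each irreducible component of $\mathcal D$ is intersected by precisely one irreducible component of $\mathcal E$, and this intersection consists of a single point; (iii) each irreducible component of $\mathcal E$ intersects exactly $\dfrac{m_1\operatorname{lcm}(m_2,\dots,m_r)}{\operatorname{lcm}(m_1,\dots,m_r)}$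 irreducible components of $\mathcal D$, and this number equals the number of irreducible components of $\mathcal D$ divided by the number of irreducible components of $\mathcal E$. -/

import Mathlib

noncomputable section

/-! Points of affine space `ℂ^(r+1)` are functions `Fin (r + 1) → ℂ`, with coordinates
`x 0, …, x r`. -/

/-- The Zariski topology on affine space `σ → ℂ`: the closed sets are the common zero loci of sets
of polynomials. It is induced from the prime spectrum of the polynomial ring through the map that
sends a point to the ideal of the polynomials vanishing there. -/
@[reducible]
def zariskiTopology (σ : Type) : TopologicalSpace (σ → ℂ) :=
  TopologicalSpace.induced
    (MvPolynomial.pointToPoint : (σ → ℂ) → PrimeSpectrum (MvPolynomial σ ℂ)) inferInstance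

theorem zariskiTopology_isClosed_iff {σ : Type} (Z : Set (σ → ℂ)) :
    @IsClosed _ (zariskiTopology σ) Z ↔
      ∃ S : Set (MvPolynomial σ ℂ), Z = {x | ∀ f ∈ S, MvPolynomial.eval x f = 0} := by
  have key : ∀ S : Set (MvPolynomial σ ℂ),
      (MvPolynomial.pointToPoint : (σ → ℂ) → PrimeSpectrum (MvPolynomial σ ℂ)) ⁻¹'
        PrimeSpectrum.zeroLocus S = {x | ∀ f ∈ S, MvPolynomial.eval x f = 0} := by
    intro S
    ext x
    simp [MvPolynomial.pointToPoint, PrimeSpectrum.mem_zeroLocus, Set.subset_def,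
      MvPolynomial.aeval_eq_eval]
  let _ := zariskiTopology σ
  rw [isClosed_induced_iff]
  constructor
  · rintro ⟨T, hT, rfl⟩
    obtain ⟨S, rfl⟩ := (PrimeSpectrum.isClosed_iff_zeroLocus T).1 hT
    exact ⟨S, key S⟩
  · rintro ⟨S, rfl⟩
    exact ⟨_, PrimeSpectrum.isClosed_zeroLocus S, key S⟩

/-- The irreducible components of a subset `S` of a topological space: the maximal irreducible
subsets of `S`. -/
def componentsOf {X : Type} [TopologicalSpace X] (S : Set X) : Set (Set X) :=
  {C | Maximal (fun T => IsIrreducible T ∧ T ⊆ S) C}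

/-- The equivalence relation on `ℂ^(r+1)` given by the orbits of the action of the group `μ_d` of
`d`-th roots of unity, `ξ · (x_0, …, x_r) = (ξ^{a_0} x_0, …, ξ^{a_r} x_r)`. -/
def cyclicSetoid {r : ℕ} (d : ℕ) (a : Fin (r + 1) → ℤ) : Setoid (Fin (r + 1) → ℂ) where
  r x y := ∃ ξ ∈ rootsOfUnity d ℂ, ∀ i, y i = ((ξ ^ a i : ℂˣ) : ℂ) * x i
  iseqv :=
    { refl := fun x => ⟨1, one_mem _, fun i => by simp⟩
      symm := by
        rintro x y ⟨ξ, hξ, h⟩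
        refine ⟨ξ⁻¹, inv_mem hξ, fun i => ?_⟩
        rw [h i, ← mul_assoc, ← Units.val_mul, ← mul_zpow]
        simp
      trans := by
        rintro x y z ⟨ξ, hξ, h⟩ ⟨η, hη, k⟩
        refine ⟨η * ξ, mul_mem hη hξ, fun i => ?_⟩
        rw [k i, h i, mul_zpow, Units.val_mul, mul_assoc] }

/-- The cyclic quotient space `X(d; a_0, …, a_r) = ℂ^(r+1) / μ_d`. -/
def CyclicQuotient {r : ℕ} (d : ℕ) (a : Fin (r + 1) → ℤ) : Type :=
  Quotient (cyclicSetoid d a)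

/-- The class `[x]` of `x` in `X(d; a_0, …, a_r)`. -/
def CyclicQuotient.mk {r : ℕ} (d : ℕ) (a : Fin (r + 1) → ℤ) (x : Fin (r + 1) → ℂ) :
    CyclicQuotient d a :=
  Quotient.mk (cyclicSetoid d a) x

/-- A pair `(x, u)` with `u ≠ 0` such that `x` lies in the closure of the `ℂ*`-orbit of `u` under
`t · u = (t^{p_0} u_0, …, t^{p_r} u_r)`; as the weights are positive, this closure is the orbit
together with the origin (`t = 0`). Such a pair represents the point `(x, [u]_ω)` of the weighted
blow-up of `ℂ^(r+1)` at the origin inside `ℂ^(r+1) × ℙ^r_ω`, where `ω = (p_0, …, p_r)`. -/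
structure BlowUpPair {r : ℕ} (p : Fin (r + 1) → ℕ) where
  x : Fin (r + 1) → ℂ
  u : Fin (r + 1) → ℂ
  u_ne_zero : u ≠ 0
  mem_closure : ∃ t : ℂ, ∀ i, x i = t ^ p i * u i

/-- Pairs are considered inside the affine space `ℂ^(r+1) × ℂ^(r+1)` with its Zariski topology. -/
instance {r : ℕ} (p : Fin (r + 1) → ℕ) : TopologicalSpace (BlowUpPair p) :=
  TopologicalSpace.induced (fun q => Sum.elim q.x q.u)
    (zariskiTopology (Fin (r + 1) ⊕ Fin (r + 1)))

/-- `(x, u)` and `(y, v)` are equivalent if `(y, [v]_ω) = ξ · (x, [u]_ω)` for some `ξ ∈ μ_d`, that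
is, `y_i = ξ^{a_i} x_i` and `v_i = t^{p_i} ξ^{a_i} u_i` for all `i`, for some `t ∈ ℂ*`. -/
def blowUpSetoid {r : ℕ} (d : ℕ) (a : Fin (r + 1) → ℤ) (p : Fin (r + 1) → ℕ) :
    Setoid (BlowUpPair p) where
  r q q' := ∃ ξ ∈ rootsOfUnity d ℂ, ∃ t : ℂˣ,
    (∀ i, q'.x i = ((ξ ^ a i : ℂˣ) : ℂ) * q.x i) ∧
    (∀ i, q'.u i = ((t ^ p i * ξ ^ a i : ℂˣ) : ℂ) * q.u i)
  iseqv :=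
    { refl := fun q => ⟨1, one_mem _, 1, fun i => by simp, fun i => by simp⟩
      symm := by
        rintro q q' ⟨ξ, hξ, t, h, k⟩
        refine ⟨ξ⁻¹, inv_mem hξ, t⁻¹, fun i => ?_, fun i => ?_⟩
        · rw [h i, ← mul_assoc, ← Units.val_mul, ← mul_zpow]
          simp
        · rw [k i, ← mul_assoc, ← Units.val_mul, inv_pow, inv_zpow, ← mul_inv, inv_mul_cancel]
          simp
      trans := by
        rintro q q' q'' ⟨ξ, hξ, t, h, k⟩ ⟨η, hη, s, h', k'⟩
        refine ⟨η * ξ, mul_mem hη hξ, s * t, fun i => ?_, fun i => ?_⟩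
        · rw [h' i, h i, mul_zpow, Units.val_mul, mul_assoc]
        · rw [k' i, k i, ← mul_assoc, ← Units.val_mul, mul_pow, mul_zpow,
            mul_mul_mul_comm] }

/-- The `ω`-weighted blow-up of `X(d; a_0, …, a_r)` at the origin, `ω = (p_0, …, p_r)`: the quotient
by `μ_d` of the `ω`-weighted blow-up of `ℂ^(r+1)` at the origin. -/
def WeightedBlowUp {r : ℕ} (d : ℕ) (a : Fin (r + 1) → ℤ) (p : Fin (r + 1) → ℕ) : Type :=
  Quotient (blowUpSetoid d a p)

/-- The class of the pair `(x, u)`, that is, the point `[(x, [u]_ω)]`. -/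
def WeightedBlowUp.mk {r : ℕ} (d : ℕ) (a : Fin (r + 1) → ℤ) (p : Fin (r + 1) → ℕ)
    (q : BlowUpPair p) : WeightedBlowUp d a p :=
  Quotient.mk (blowUpSetoid d a p) q

/-- The Zariski topology of the weighted blow-up, as a quotient topology. -/
instance {r : ℕ} (d : ℕ) (a : Fin (r + 1) → ℤ) (p : Fin (r + 1) → ℕ) :
    TopologicalSpace (WeightedBlowUp d a p) :=
  TopologicalSpace.coinduced (WeightedBlowUp.mk d a p) inferInstance

/-- The projection `π : [(x, [u]_ω)] ↦ [x]`. -/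
def WeightedBlowUp.proj {r : ℕ} (d : ℕ) (a : Fin (r + 1) → ℤ) (p : Fin (r + 1) → ℕ) :
    WeightedBlowUp d a p → CyclicQuotient d a :=
  Quotient.lift (fun q : BlowUpPair p => CyclicQuotient.mk d a q.x) (by
    rintro q q' ⟨ξ, hξ, _, h, _⟩
    exact Quotient.sound ⟨ξ, hξ, h⟩)

/-- The exceptional divisor `π⁻¹(0)`: the set of all points `[(0, [u]_ω)]`, which is the quotient
`ℙ^r_ω(d; a_0, …, a_r)` of the weighted projective space `ℙ^r_ω` by `μ_d`. -/
def WeightedBlowUp.exceptionalDivisor {r : ℕ} (d : ℕ) (a : Fin (r + 1) → ℤ)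
    (p : Fin (r + 1) → ℕ) : Set (WeightedBlowUp d a p) :=
  WeightedBlowUp.proj d a p ⁻¹' {CyclicQuotient.mk d a 0}

/-- The subset of `ℙ^r_ω(d; a_0, …, a_r) = π⁻¹(0)` defined by a set of equations in the homogeneous
coordinates `[u_0 : … : u_r]_ω`. -/
def WeightedBlowUp.exceptionalLocus {r : ℕ} (d : ℕ) (a : Fin (r + 1) → ℤ)
    (p : Fin (r + 1) → ℕ) (S : Set (MvPolynomial (Fin (r + 1)) ℂ)) :
    Set (WeightedBlowUp d a p) :=
  {P | P ∈ exceptionalDivisor d a p ∧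
    ∃ q : BlowUpPair p, P = mk d a p q ∧ ∀ f ∈ S, MvPolynomial.eval q.u f = 0}

/-- The subset of `X(d; a_0, …, a_r)` defined by a set of equations in the coordinates. -/
def CyclicQuotient.locus {r : ℕ} (d : ℕ) (a : Fin (r + 1) → ℤ)
    (S : Set (MvPolynomial (Fin (r + 1)) ℂ)) : Set (CyclicQuotient d a) :=
  {P | ∃ x : Fin (r + 1) → ℂ, P = mk d a x ∧ ∀ f ∈ S, MvPolynomial.eval x f = 0}

/-- The strict transform of a subset `Z` of `X(d; a_0, …, a_r)`: the Zariski closure of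
`π⁻¹(Z \ {0})`. -/
def WeightedBlowUp.strictTransform {r : ℕ} (d : ℕ) (a : Fin (r + 1) → ℤ)
    (p : Fin (r + 1) → ℕ) (Z : Set (CyclicQuotient d a)) : Set (WeightedBlowUp d a p) :=
  closure (proj d a p ⁻¹' (Z \ {CyclicQuotient.mk d a 0}))

/-- The polynomials `x_k^{m_k} + x_{k+1}^{m_{k+1}}, …, x_{r-1}^{m_{r-1}} + x_r^{m_r}`. -/
def chainEquations {r : ℕ} (m : Fin (r + 1) → ℕ) (k : ℕ) :
    Set (MvPolynomial (Fin (r + 1)) ℂ) :=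
  {f | ∃ i j : Fin (r + 1), k ≤ i.val ∧ j.val = i.val + 1 ∧
    f = MvPolynomial.X i ^ m i + MvPolynomial.X j ^ m j}

/-- The equations `x_0^{m_0} + x_1^{m_1} + x_2^{m_2} = 0` and `x_i^{m_i} + x_{i+1}^{m_{i+1}} = 0`
for `2 ≤ i < r` (used for `r ≥ 2`). -/
def equationsE {r : ℕ} (m : Fin (r + 1) → ℕ) : Set (MvPolynomial (Fin (r + 1)) ℂ) :=
  {MvPolynomial.X 0 ^ m 0 + MvPolynomial.X 1 ^ m 1 + MvPolynomial.X 2 ^ m 2} ∪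
    chainEquations m 2

/-- The equations `x_0^{m_0} = 0` and `x_i^{m_i} + x_{i+1}^{m_{i+1}} = 0` for `1 ≤ i < r`. -/
def equationsD {r : ℕ} (m : Fin (r + 1) → ℕ) : Set (MvPolynomial (Fin (r + 1)) ℂ) :=
  {MvPolynomial.X 0 ^ m 0} ∪ chainEquations m 1

/-- `lcm (m_k, …, m_r)`. -/
def lcmFrom {r : ℕ} (m : Fin (r + 1) → ℕ) (k : ℕ) : ℕ :=
  (Finset.univ.filter fun i : Fin (r + 1) => k ≤ i.val).lcm m

/-- The product `m_k ⋯ m_r`. -/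
def prodFrom {r : ℕ} (m : Fin (r + 1) → ℕ) (k : ℕ) : ℕ :=
  ∏ i ∈ Finset.univ.filter (fun i : Fin (r + 1) => k ≤ i.val), m i

end

/-!
Write `N` for the common weighted degree `p i * m i`. A solution `u` of the chain equations from
index `k` on has the form `u i = t ^ p i * b i` for `i ≥ k`, where `b i ^ m i = (-1) ^ i`
(`signedTuples`). For nonzero solutions the tuple `b` is unique up to the action of `ℂ*` on the
coordinates of index at least `k`. By proportionality of the weights of index at least `1`, the
group `μ_d` acts on these coordinates through `ℂ*`, so it preserves the orbit closures and passing
to the quotient by `μ_d` identifies none of them; the powers `u i ^ m i`, hence all equations, are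
invariant under `μ_d` because `d` divides `a i * m i`.

The strict transform `𝒟` is therefore the union of the curves `{[(s · b, [b])] | s ∈ ℂ}`, where
`b 0` is replaced by `0`, one for each orbit for `k = 1`. They are irreducible as images of the
affine line, pairwise disjoint, and each contains one point of the exceptional divisor. The curve
`ℰ` is the union of the sets given by `(u 2, …, u r) ∈ ℂ · (b 2, …, b r)` and
`u 0 ^ m 0 + u 1 ^ m 1 + u 2 ^ m 2 = 0`, one for each orbit for `k = 2`. Each of them is the image
of the surface `x ^ m 0 + y ^ m 1 + s ^ N = 0` without the origin, which is irreducible by an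
Eisenstein argument (`prime_surface`) and the Nullstellensatz. Both kinds of sets are closed because
a monomial curve is cut out by its vanishing ideal (`exists_param_of_forall_ker`). So these sets are
the irreducible components (`componentsOf_eq_image`), and the curve of `b` meets the component of
`ℰ` belonging to `b'` exactly when `b` and `b'` are in one orbit for `k = 2`.

It remains to count orbits. The tuples `b` form a torsor under the product `G` of the groups of
`m i`-th roots of unity, and orbits correspond to cosets of the subgroup of `G` whose coordinates of
index at least `k` are of the form `t ^ p i` (`monomialSubgroup`). In these coordinates this
subgroup is cyclic of order `lcm (m k, …, m r)`, so its index is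
`m k ⋯ m r / lcm (m k, …, m r)` (`index_monomialSubgroup_mul`). The components of `𝒟` that meet a
given component of `ℰ` are counted by the relative index of the subgroups for `k = 1` and `k = 2`.
-/

noncomputable section

variable {r : ℕ}

/-! ### Irreducible components of finite unions -/

theorem componentsOf_eq_image {X ι : Type} [TopologicalSpace X] {B : Set ι} {c : ι → Set X}
    (hfin : (c '' B).Finite) (hclosed : ∀ b ∈ B, IsClosed (c b))
    (hirr : ∀ b ∈ B, IsIrreducible (c b)) (hle : ∀ b ∈ B, ∀ b' ∈ B, c b ⊆ c b' → c b = c b')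
    {S : Set X} (hS : S = ⋃ b ∈ B, c b) : componentsOf S = c '' B := by
  have key : ∀ T : Set X, IsIrreducible T → T ⊆ S → ∃ b ∈ B, T ⊆ c b := by
    intro T hT hTS
    obtain ⟨_, hZ, hTZ⟩ := isIrreducible_iff_sUnion_isClosed.1 hT hfin.toFinset
      (by
        intro Z hZ
        obtain ⟨b, hb, rfl⟩ := hfin.mem_toFinset.1 hZ
        exact hclosed b hb)
      (by
        intro x hx
        have := hTS hx
        rw [hS] at this
        simp only [Set.mem_iUnion] at this
        obtain ⟨b, hb, hxb⟩ := this
        exact ⟨c b, by simpa using ⟨b, hb, rfl⟩, hxb⟩)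
    obtain ⟨b, hb, rfl⟩ := hfin.mem_toFinset.1 hZ
    exact ⟨b, hb, hTZ⟩
  have hsub : ∀ b ∈ B, c b ⊆ S := fun b hb => hS ▸ Set.subset_biUnion_of_mem hb
  ext T
  constructor
  · rintro ⟨⟨hT, hTS⟩, hmax⟩
    obtain ⟨b, hb, hTb⟩ := key T hT hTS
    exact ⟨b, hb, (hmax ⟨hirr b hb, hsub b hb⟩ hTb).antisymm hTb⟩
  · rintro ⟨b, hb, rfl⟩
    refine ⟨⟨hirr b hb, hsub b hb⟩, fun T hT hbT => ?_⟩
    obtain ⟨b', hb', hTb'⟩ := key T hT.1 hT.2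
    exact (hle b hb b' hb' (hbT.trans hTb')) ▸ hTb'

/-! ### Monomial curves -/

/-- The vanishing ideal of a monomial curve `t ↦ (t ^ p i * b i)` cuts out exactly the curve.
The polynomial ring `ℂ[t]` is integral over the image of the coordinate ring, since it contains a
nonzero multiple of a positive power of `t`; hence every maximal ideal containing the kernel lies
below a maximal ideal of `ℂ[t]`, which is a value of the parameter. -/
theorem exists_param_of_forall_ker {σ : Type} [Finite σ] (p : σ → ℕ) (b : σ → ℂ) {i₀ : σ}
    (hp : 0 < p i₀) (hb : b i₀ ≠ 0) (u : σ → ℂ)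
    (hu : ∀ f : MvPolynomial σ ℂ,
      (∀ t : ℂ, MvPolynomial.eval (fun i => t ^ p i * b i) f = 0) → MvPolynomial.eval u f = 0) :
    ∃ t : ℂ, ∀ i, u i = t ^ p i * b i := by
  let φ : MvPolynomial σ ℂ →ₐ[ℂ] MvPolynomial Unit ℂ :=
    MvPolynomial.aeval fun i => MvPolynomial.X () ^ p i * MvPolynomial.C (b i)
  have hφ : ∀ (f : MvPolynomial σ ℂ) (y : Unit → ℂ),
      MvPolynomial.eval y (φ f) = MvPolynomial.eval (fun i => y () ^ p i * b i) f := by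
    intro f y
    have h : (MvPolynomial.aeval y).comp φ =
        MvPolynomial.aeval fun i => y () ^ p i * b i := by
      ext i
      simp [φ]
    simpa [MvPolynomial.aeval_eq_eval] using DFunLike.congr_fun h f
  let _ : Algebra (MvPolynomial σ ℂ) (MvPolynomial Unit ℂ) := φ.toRingHom.toAlgebra
  have hmap : ∀ f, algebraMap (MvPolynomial σ ℂ) (MvPolynomial Unit ℂ) f = φ f := fun _ => rfl
  have hC : ∀ z : ℂ, IsIntegral (MvPolynomial σ ℂ) (MvPolynomial.C z : MvPolynomial Unit ℂ) := by
    intro z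
    have : (MvPolynomial.C z : MvPolynomial Unit ℂ) =
        algebraMap (MvPolynomial σ ℂ) _ (MvPolynomial.C z) := by
      rw [hmap]
      exact (φ.commutes z).symm
    rw [this]
    exact isIntegral_algebraMap
  have hX : IsIntegral (MvPolynomial σ ℂ) (MvPolynomial.X () : MvPolynomial Unit ℂ) := by
    apply IsIntegral.of_pow hp
    have : (MvPolynomial.X () ^ p i₀ : MvPolynomial Unit ℂ) =
        algebraMap (MvPolynomial σ ℂ) _ (MvPolynomial.C (b i₀)⁻¹ * MvPolynomial.X i₀) := by
      rw [hmap, map_mul, MvPolynomial.aeval_X, MvPolynomial.aeval_C, mul_left_comm]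
      change _ = _ * (MvPolynomial.C _ * _)
      rw [← map_mul, inv_mul_cancel₀ hb, map_one, mul_one]
    rw [this]
    exact isIntegral_algebraMap
  have : Algebra.IsIntegral (MvPolynomial σ ℂ) (MvPolynomial Unit ℂ) := by
    constructor
    intro f
    induction f using MvPolynomial.induction_on with
    | C z => exact hC z
    | add f g hf hg => exact hf.add hg
    | mul_X f i hf => exact hf.mul hX
  obtain ⟨Q, hQ, hQu⟩ := Ideal.exists_ideal_over_maximal_of_isIntegral (S := MvPolynomial Unit ℂ)
    (MvPolynomial.vanishingIdeal ℂ {u}) (by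
      intro f hf
      rw [MvPolynomial.mem_vanishingIdeal_singleton_iff, MvPolynomial.aeval_eq_eval]
      refine hu f fun t => ?_
      rw [← hφ f fun _ => t, ← hmap f, RingHom.mem_ker.1 hf, map_zero])
  obtain ⟨y, rfl⟩ := (MvPolynomial.isMaximal_iff_eq_vanishingIdeal_singleton).1 hQ
  refine ⟨y (), fun i => ?_⟩
  have h : MvPolynomial.X i - MvPolynomial.C (u i) ∈
      MvPolynomial.vanishingIdeal ℂ ({u} : Set (σ → ℂ)) := by
    simp
  rw [← hQu, Ideal.mem_comap, hmap, MvPolynomial.mem_vanishingIdeal_singleton_iff,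
    MvPolynomial.aeval_eq_eval, hφ] at h
  simpa [sub_eq_zero, eq_comm] using h

/-! ### Irreducibility of the surfaces `x ^ l + y ^ m + s ^ (p m) = 0` -/

theorem pderiv_mem_of_mem_sq {R σ : Type} [CommRing R] (P : Ideal (MvPolynomial σ R)) (i : σ)
    {f : MvPolynomial σ R} (hf : f ∈ P ^ 2) : MvPolynomial.pderiv i f ∈ P := by
  rw [pow_two] at hf
  induction hf using Submodule.mul_induction_on' with
  | mem_mul_mem x hx y hy =>
    rw [Derivation.leibniz]
    exact P.add_mem (P.mul_mem_right _ hx) (P.mul_mem_right _ hy)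
  | add x hx y hy h h' => rw [map_add]; exact P.add_mem h h'

/-- The surface polynomial `x ^ l + y ^ m + s ^ (p * m)` is prime: as a polynomial in `x` it is
Eisenstein at the prime ideal of the curve `y = c s ^ p`, where `c ^ m = -1`, because
`y ^ m + s ^ (p * m)` vanishes on this curve while its derivative with respect to `y` does not. -/
theorem prime_surface {l m p : ℕ} (hl : 0 < l) (hm : 0 < m) :
    Prime (MvPolynomial.X 0 ^ l + MvPolynomial.X 1 ^ m + MvPolynomial.X 2 ^ (p * m) :
      MvPolynomial (Fin 3) ℂ) := by
  obtain ⟨c, hc⟩ := IsAlgClosed.exists_pow_nat_eq (-1 : ℂ) hm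
  have hc0 : c ≠ 0 := by
    rintro rfl
    rw [zero_pow hm.ne'] at hc
    norm_num at hc
  let φ : MvPolynomial (Fin 2) ℂ →ₐ[ℂ] Polynomial ℂ :=
    MvPolynomial.aeval ![Polynomial.C c * Polynomial.X ^ p, Polynomial.X]
  let P : Ideal (MvPolynomial (Fin 2) ℂ) := RingHom.ker φ
  have hP : P.IsPrime := RingHom.ker_isPrime φ
  let g : MvPolynomial (Fin 2) ℂ := MvPolynomial.X 0 ^ m + MvPolynomial.X 1 ^ (p * m)
  have hg : g ∈ P := by
    rw [RingHom.mem_ker]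
    simp only [φ, g, map_add, map_pow, MvPolynomial.aeval_X, Matrix.cons_val_zero,
      Matrix.cons_val_one, mul_pow, ← pow_mul]
    rw [← map_pow, hc]
    simp
  have hg2 : g ∉ P ^ 2 := by
    intro h
    have h' := pderiv_mem_of_mem_sq P 0 h
    rw [RingHom.mem_ker] at h'
    simp [φ, g, MvPolynomial.pderiv_X, hc0, hm.ne'] at h'
  rw [← MulEquiv.prime_iff (MvPolynomial.finSuccEquiv ℂ 2)]
  have hF : MvPolynomial.finSuccEquiv ℂ 2 (MvPolynomial.X 0 ^ l + MvPolynomial.X 1 ^ m +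
      MvPolynomial.X 2 ^ (p * m)) = Polynomial.X ^ l + Polynomial.C g := by
    have h1 : MvPolynomial.finSuccEquiv ℂ 2 (MvPolynomial.X 1) =
        Polynomial.C (MvPolynomial.X 0) := MvPolynomial.finSuccEquiv_X_succ (j := (0 : Fin 2))
    have h2 : MvPolynomial.finSuccEquiv ℂ 2 (MvPolynomial.X 2) =
        Polynomial.C (MvPolynomial.X 1) := MvPolynomial.finSuccEquiv_X_succ (j := (1 : Fin 2))
    simp only [map_add, map_pow, h1, h2, MvPolynomial.finSuccEquiv_X_zero, g, add_assoc]
  rw [hF]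
  have hmonic := Polynomial.monic_X_pow_add_C g hl.ne'
  have hdeg := Polynomial.degree_X_pow_add_C hl g
  refine (Polynomial.irreducible_of_eisenstein_criterion hP ?_ ?_ ?_ ?_ hmonic.isPrimitive).prime
  · rw [hmonic]
    exact fun h => hP.ne_top (P.eq_top_iff_one.2 h)
  · intro n hn
    rw [hdeg, Nat.cast_lt] at hn
    rw [Polynomial.coeff_add, Polynomial.coeff_X_pow, if_neg hn.ne, zero_add,
      Polynomial.coeff_C]
    split_ifs
    · exact hg
    · exact P.zero_mem
  · rw [hdeg]
    exact_mod_cast hl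
  · simpa [hl.ne, hl.ne'] using hg2

/-- Removing the points with `s = 0` from the surface does not change its vanishing ideal. -/
theorem surface_dvd_of_vanishing {l m p : ℕ} (hl : 0 < l) (hm : 0 < m) {f : MvPolynomial (Fin 3) ℂ}
    (hf : ∀ y : Fin 3 → ℂ, y 2 ≠ 0 → y 0 ^ l + y 1 ^ m + y 2 ^ (p * m) = 0 →
      MvPolynomial.eval y f = 0) :
    MvPolynomial.X 0 ^ l + MvPolynomial.X 1 ^ m + MvPolynomial.X 2 ^ (p * m) ∣ f := by
  set F : MvPolynomial (Fin 3) ℂ :=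
    MvPolynomial.X 0 ^ l + MvPolynomial.X 1 ^ m + MvPolynomial.X 2 ^ (p * m) with hF
  have hprime : Prime F := prime_surface hl hm
  have hI : (Ideal.span {F}).IsPrime := (Ideal.span_singleton_prime hprime.ne_zero).2 hprime
  have hdvd : ∀ h : MvPolynomial (Fin 3) ℂ,
      (∀ y : Fin 3 → ℂ, y 0 ^ l + y 1 ^ m + y 2 ^ (p * m) = 0 → MvPolynomial.eval y h = 0) →
      F ∣ h := by
    intro h hh
    rw [← Ideal.mem_span_singleton,
      ← MvPolynomial.IsPrime.vanishingIdeal_zeroLocus (K := ℂ) (Ideal.span {F})]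
    intro y hy
    rw [MvPolynomial.zeroLocus_span] at hy
    rw [MvPolynomial.aeval_eq_eval]
    apply hh
    simpa [hF] using hy F rfl
  refine (hprime.dvd_or_dvd (hdvd (MvPolynomial.X 2 * f) fun y hy => ?_)).resolve_left ?_
  · rw [map_mul, MvPolynomial.eval_X]
    by_cases h2 : y 2 = 0
    · rw [h2, zero_mul]
    · rw [hf y h2 hy, mul_zero]
  · rintro ⟨h, hh⟩
    -- the point `(c, 0, 1)` with `c ^ l = -1` lies on the surface
    obtain ⟨c, hc⟩ := IsAlgClosed.exists_pow_nat_eq (-1 : ℂ) hl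
    have := congrArg (MvPolynomial.eval ![c, 0, 1]) hh
    simp [hF, hc, hm.ne'] at this

/-! ### Counting orbits of tuples of roots of unity -/

theorem ncard_range_of_eq_iff {G α : Type} [Group G] (K : Subgroup G) (f : G → α)
    (hf : ∀ g h, f g = f h ↔ g⁻¹ * h ∈ K) : (Set.range f).ncard = K.index := by
  rw [Subgroup.index, ← Nat.card_coe_set_eq]
  refine Nat.card_congr (Equiv.ofBijective (fun q : G ⧸ K => (⟨Quotient.lift f (fun g h hgh =>
    (hf g h).2 (QuotientGroup.leftRel_apply.1 hgh)) q, ?_⟩ : Set.range f)) ⟨?_, ?_⟩).symm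
  · induction q using Quotient.inductionOn with | h g => exact ⟨g, rfl⟩
  · intro q q'
    induction q using Quotient.inductionOn
    induction q' using Quotient.inductionOn
    intro h
    exact Quotient.sound (QuotientGroup.leftRel_apply.2 ((hf _ _).1 (congrArg Subtype.val h)))
  · rintro ⟨_, g, rfl⟩
    exact ⟨Quotient.mk _ g, rfl⟩

theorem ncard_image_coset_of_eq_iff {G α : Type} [Group G] (K L : Subgroup G) (f : G → α)
    (hf : ∀ g h, f g = f h ↔ g⁻¹ * h ∈ K) (g₀ : G) :
    (f '' {g | g₀⁻¹ * g ∈ L}).ncard = K.relIndex L := by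
  rw [Subgroup.relIndex, ← ncard_range_of_eq_iff (K.subgroupOf L) fun g : L => f (g₀ * g)]
  · congr 1
    ext y
    constructor
    · rintro ⟨g, hg, rfl⟩
      exact ⟨⟨_, hg⟩, by simp⟩
    · rintro ⟨g, rfl⟩
      exact ⟨g₀ * g, by simp, rfl⟩
  · intro g h
    rw [hf, Subgroup.mem_subgroupOf]
    simp [mul_assoc]

/-- The tuples `(t ^ p i)`, up to the coordinates with index less than `k`, in the product of the
groups of `m i`-th roots of unity. -/
def monomialSubgroup (p m : Fin (r + 1) → ℕ) (k : ℕ) :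
    Subgroup (∀ i, rootsOfUnity (m i) ℂ) where
  carrier := {g | ∃ t : ℂˣ, ∀ i, k ≤ i.val → (g i : ℂˣ) = t ^ p i}
  one_mem' := ⟨1, by simp⟩
  mul_mem' := by
    rintro g h ⟨t, ht⟩ ⟨s, hs⟩
    exact ⟨t * s, fun i hi => by simp [ht i hi, hs i hi, mul_pow]⟩
  inv_mem' := by
    rintro g ⟨t, ht⟩
    exact ⟨t⁻¹, fun i hi => by simp [ht i hi]⟩

theorem lcmFrom_dvd_iff (m : Fin (r + 1) → ℕ) (k n : ℕ) :
    lcmFrom m k ∣ n ↔ ∀ i : Fin (r + 1), k ≤ i.val → m i ∣ n := by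
  simp [lcmFrom, Finset.lcm_dvd_iff]

/-- In the coordinates of index at least `k`, the subgroup `monomialSubgroup p m k` is cyclic,
generated by the tuple `(ζ ^ p i)` for a primitive `N`-th root of unity `ζ`; the `i`-th entry of
this tuple has order `m i`. -/
theorem index_monomialSubgroup_mul {p m : Fin (r + 1) → ℕ} (hp : ∀ i, 0 < p i)
    (hm : ∀ i, 0 < m i) {N : ℕ} (hN : ∀ i, p i * m i = N) {k : ℕ} (hk : k ≤ r) :
    (monomialSubgroup p m k).index * lcmFrom m k = prodFrom m k := by
  have : ∀ i, NeZero (m i) := fun i => ⟨(hm i).ne'⟩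
  have : NeZero N := ⟨by rw [← hN 0]; exact (Nat.mul_pos (hp 0) (hm 0)).ne'⟩
  have hζ' := (Complex.isPrimitiveRoot_exp N (NeZero.ne N))
  set ζ : ℂˣ := (hζ'.isUnit (NeZero.ne N)).unit
  have hζ : IsPrimitiveRoot ζ N := hζ'.isUnit_unit (NeZero.ne N)
  let res : (∀ i, rootsOfUnity (m i) ℂ) →*
      (∀ i : {i : Fin (r + 1) // k ≤ i.val}, rootsOfUnity (m i) ℂ) :=
    MonoidHom.pi fun i => Pi.evalMonoidHom _ i.1
  have hres_apply : ∀ g i, res g i = g i.1 := fun _ _ => rfl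
  have hres : Function.Surjective res := by
    intro h
    refine ⟨fun i => if hi : k ≤ i.val then h ⟨i, hi⟩ else 1, ?_⟩
    funext i
    rw [hres_apply, dif_pos i.2]
  let z : ∀ i : {i : Fin (r + 1) // k ≤ i.val}, rootsOfUnity (m i) ℂ := fun i => ⟨ζ ^ p i, by
    rw [mem_rootsOfUnity, ← pow_mul, hN, hζ.pow_eq_one]⟩
  have hz : ∀ (n : ℕ) i, ((z ^ n) i : ℂˣ) = ζ ^ (p i.1 * n) := fun n i => (pow_mul _ _ _).symm
  have hcomap : monomialSubgroup p m k = (Subgroup.zpowers z).comap res := by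
    ext g
    rw [Subgroup.mem_comap, Subgroup.mem_zpowers_iff]
    constructor
    · rintro ⟨t, ht⟩
      have htN : t ∈ rootsOfUnity N ℂ := by
        have h := (g ⟨k, by omega⟩).2
        rwa [ht _ le_rfl, mem_rootsOfUnity, ← pow_mul, hN] at h
      obtain ⟨n, -, rfl⟩ := hζ.eq_pow_of_mem_rootsOfUnity htN
      refine ⟨n, ?_⟩
      funext i
      apply Subtype.ext
      rw [zpow_natCast, hz, hres_apply, ht i i.2, mul_comm, pow_mul]
    · rintro ⟨n, hn⟩
      refine ⟨ζ ^ n, fun i hi => ?_⟩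
      have h : (ζ ^ p i) ^ n = (g i : ℂˣ) := congrArg Subtype.val (congrFun hn ⟨i, hi⟩)
      rw [← h, ← zpow_natCast, ← zpow_natCast, zpow_comm]
  have hord : orderOf z = lcmFrom m k := by
    apply Nat.dvd_antisymm
    · rw [orderOf_dvd_iff_pow_eq_one]
      funext i
      apply Subtype.ext
      have := (lcmFrom_dvd_iff m k _).1 dvd_rfl i i.2
      rw [hz, Pi.one_apply, Subgroup.coe_one, hζ.pow_eq_one_iff_dvd, ← hN i.1]
      exact mul_dvd_mul_left _ this
    · rw [lcmFrom_dvd_iff]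
      intro i hi
      have := congrArg Subtype.val (congrFun (pow_orderOf_eq_one z) ⟨i, hi⟩)
      rw [hz, Pi.one_apply, Subgroup.coe_one, hζ.pow_eq_one_iff_dvd, ← hN i] at this
      exact Nat.dvd_of_mul_dvd_mul_left (hp i) this
  rw [hcomap, Subgroup.index_comap_of_surjective _ hres, ← hord, ← Nat.card_zpowers, mul_comm,
    Subgroup.card_mul_index, Nat.card_pi, prodFrom,
    Finset.prod_subtype (p := fun i : Fin (r + 1) => k ≤ i.val) _ (by simp)]
  exact Finset.prod_congr rfl fun i _ => by
    rw [Complex.card_rootsOfUnity]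

theorem monomialSubgroup_mono (p m : Fin (r + 1) → ℕ) {k l : ℕ} (h : k ≤ l) :
    monomialSubgroup p m k ≤ monomialSubgroup p m l := by
  rintro g ⟨t, ht⟩
  exact ⟨t, fun i hi => ht i (h.trans hi)⟩

theorem fin_val_one (hr : 2 ≤ r) : ((1 : Fin (r + 1)) : ℕ) = 1 := by
  rw [Fin.val_one']
  exact Nat.mod_eq_of_lt (by omega)

theorem fin_val_two (hr : 2 ≤ r) : ((2 : Fin (r + 1)) : ℕ) = 2 :=
  Nat.mod_eq_of_lt (show 2 < r + 1 by omega)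

theorem prodFrom_one (m : Fin (r + 1) → ℕ) (hr : 2 ≤ r) : prodFrom m 1 = m 1 * prodFrom m 2 := by
  have h1 := fin_val_one hr
  rw [prodFrom, prodFrom, ← Finset.prod_insert (by
    rw [Finset.mem_filter, h1]
    omega)]
  congr 1
  ext i
  simp only [Finset.mem_filter, Finset.mem_univ, true_and, Finset.mem_insert, Fin.ext_iff, h1]
  omega

/-! ### Orbit closures and signed tuples -/

/-- The points whose coordinates of index at least `k` agree with those of a point of the closure
`{(t ^ p i * b i) | t : ℂ}` of the `ℂ*`-orbit of `b`; the other coordinates are arbitrary. -/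
def orbitClosure (p : Fin (r + 1) → ℕ) (k : ℕ) (b : Fin (r + 1) → ℂ) : Set (Fin (r + 1) → ℂ) :=
  {u | ∃ t : ℂ, ∀ i, k ≤ i.val → u i = t ^ p i * b i}

/-- The tuples `b` with `b i ^ m i = (-1) ^ i`. They normalise the solutions of the chain equations
`u i ^ m i + u (i + 1) ^ m (i + 1) = 0` up to the action of `ℂ*`. -/
def signedTuples (m : Fin (r + 1) → ℕ) : Set (Fin (r + 1) → ℂ) :=
  {b | ∀ i, b i ^ m i = (-1) ^ i.val}

theorem signedTuples_ne_zero {m : Fin (r + 1) → ℕ} (hm : ∀ i, 0 < m i) {b : Fin (r + 1) → ℂ}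
    (hb : b ∈ signedTuples m) (i : Fin (r + 1)) : b i ≠ 0 := by
  intro h
  have := hb i
  rw [h, zero_pow (hm i).ne'] at this
  exact pow_ne_zero _ (by norm_num) this.symm

theorem signedTuples_nonempty {m : Fin (r + 1) → ℕ} (hm : ∀ i, 0 < m i) :
    (signedTuples m).Nonempty := by
  choose b hb using fun i : Fin (r + 1) =>
    IsAlgClosed.exists_pow_nat_eq ((-1 : ℂ) ^ i.val) (hm i)
  exact ⟨b, hb⟩

theorem self_mem_orbitClosure (p : Fin (r + 1) → ℕ) (k : ℕ) (b : Fin (r + 1) → ℂ) :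
    b ∈ orbitClosure p k b := ⟨1, by simp⟩

theorem orbitClosure_subset_of_mem {p : Fin (r + 1) → ℕ} {k : ℕ} {b b' : Fin (r + 1) → ℂ}
    (h : b' ∈ orbitClosure p k b) : orbitClosure p k b' ⊆ orbitClosure p k b := by
  obtain ⟨t, ht⟩ := h
  rintro u ⟨s, hs⟩
  exact ⟨s * t, fun i hi => by rw [hs i hi, ht i hi, mul_pow, mul_assoc]⟩

theorem orbitClosure_mono (p : Fin (r + 1) → ℕ) {k l : ℕ} (h : k ≤ l) (b : Fin (r + 1) → ℂ) :
    orbitClosure p k b ⊆ orbitClosure p l b := by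
  rintro u ⟨t, ht⟩
  exact ⟨t, fun i hi => ht i (h.trans hi)⟩

theorem mem_orbitClosure_of_common {p : Fin (r + 1) → ℕ} (hp : ∀ i, 0 < p i) {k : ℕ}
    {b b' u : Fin (r + 1) → ℂ} (hu : u ∈ orbitClosure p k b) (hu' : u ∈ orbitClosure p k b')
    {i : Fin (r + 1)} (hi : k ≤ i.val) (hui : u i ≠ 0) : b' ∈ orbitClosure p k b := by
  obtain ⟨t, ht⟩ := hu
  obtain ⟨s, hs⟩ := hu'
  have hs0 : s ≠ 0 := by
    rintro rfl
    exact hui (by rw [hs i hi, zero_pow (hp i).ne', zero_mul])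
  refine ⟨t / s, fun j hj => ?_⟩
  rw [div_pow, div_mul_eq_mul_div, ← ht j hj, hs j hj, mul_div_cancel_left₀]
  exact pow_ne_zero _ hs0

theorem orbitClosure_eq_of_mem {p m : Fin (r + 1) → ℕ} (hp : ∀ i, 0 < p i) (hm : ∀ i, 0 < m i)
    {k : ℕ} (hk : k ≤ r) {b b' : Fin (r + 1) → ℂ} (hb' : b' ∈ signedTuples m)
    (h : b' ∈ orbitClosure p k b) : orbitClosure p k b = orbitClosure p k b' :=
  (orbitClosure_subset_of_mem (mem_orbitClosure_of_common hp
    (self_mem_orbitClosure p k b') h (i := ⟨k, by omega⟩) le_rfl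
    (signedTuples_ne_zero hm hb' _))).antisymm (orbitClosure_subset_of_mem h)

theorem pow_eq_of_mem_orbitClosure {p m : Fin (r + 1) → ℕ} {N : ℕ} (hN : ∀ i, p i * m i = N)
    {k : ℕ} {b u : Fin (r + 1) → ℂ} (hb : b ∈ signedTuples m) (hu : u ∈ orbitClosure p k b) :
    ∃ z : ℂ, ∀ i, k ≤ i.val → u i ^ m i = (-1) ^ i.val * z := by
  obtain ⟨t, ht⟩ := hu
  exact ⟨t ^ N, fun i hi => by rw [ht i hi, mul_pow, ← pow_mul, hN, hb i, mul_comm]⟩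

/-- The chain equations from index `k` on. -/
def SatisfiesChain (m : Fin (r + 1) → ℕ) (k : ℕ) (u : Fin (r + 1) → ℂ) : Prop :=
  ∀ i j : Fin (r + 1), k ≤ i.val → j.val = i.val + 1 → u i ^ m i + u j ^ m j = 0

theorem satisfiesChain_of_mem_orbitClosure {p m : Fin (r + 1) → ℕ} {N : ℕ}
    (hN : ∀ i, p i * m i = N) {k : ℕ} {b u : Fin (r + 1) → ℂ} (hb : b ∈ signedTuples m)
    (hu : u ∈ orbitClosure p k b) : SatisfiesChain m k u := by
  obtain ⟨z, hz⟩ := pow_eq_of_mem_orbitClosure hN hb hu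
  intro i j hi hj
  rw [hz i hi, hz j (by omega), hj]
  ring

theorem exists_mem_orbitClosure_of_satisfiesChain {p m : Fin (r + 1) → ℕ} (hp : ∀ i, 0 < p i)
    (hm : ∀ i, 0 < m i) {N : ℕ} (hN : ∀ i, p i * m i = N) {k : ℕ} (hk : k ≤ r)
    {u : Fin (r + 1) → ℂ} (hu : SatisfiesChain m k u) :
    ∃ b ∈ signedTuples m, u ∈ orbitClosure p k b := by
  have hN0 : 0 < N := hN 0 ▸ Nat.mul_pos (hp 0) (hm 0)
  obtain ⟨b, hb⟩ := signedTuples_nonempty hm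
  obtain ⟨t, ht⟩ := IsAlgClosed.exists_pow_nat_eq
    ((-1 : ℂ) ^ k * u ⟨k, by omega⟩ ^ m ⟨k, by omega⟩) hN0
  have key : ∀ n (hn : n < r + 1), k ≤ n → u ⟨n, hn⟩ ^ m ⟨n, hn⟩ = (-1) ^ n * t ^ N := by
    intro n hn hkn
    induction n, hkn using Nat.le_induction with
    | base => rw [ht, ← mul_assoc, ← mul_pow]; simp
    | succ n hkn ih =>
      have h := hu ⟨n, by omega⟩ ⟨n + 1, hn⟩ hkn rfl
      rw [ih (by omega)] at h
      rw [pow_succ]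
      linear_combination h
  by_cases ht0 : t = 0
  · refine ⟨b, hb, 0, fun i hi => ?_⟩
    have h := key i.val i.2 hi
    rw [ht0, zero_pow hN0.ne', mul_zero] at h
    rw [zero_pow (hp i).ne', zero_mul]
    exact eq_zero_of_pow_eq_zero h
  · refine ⟨fun i => if k ≤ i.val then u i / t ^ p i else b i, fun i => ?_, t, fun i hi => ?_⟩
    · dsimp only
      split_ifs with hi
      · rw [div_pow, ← pow_mul, hN, key i.val i.2 hi, mul_div_cancel_right₀]
        exact pow_ne_zero _ ht0
      · exact hb i
    · dsimp only
      rw [if_pos hi, mul_div_cancel₀]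
      exact pow_ne_zero _ ht0

/-- Orbit closures are Zariski closed. -/
theorem exists_equations_orbitClosure {p m : Fin (r + 1) → ℕ} (hp : ∀ i, 0 < p i)
    (hm : ∀ i, 0 < m i) {k : ℕ} (hk : k ≤ r) {b : Fin (r + 1) → ℂ} (hb : b ∈ signedTuples m) :
    ∃ S : Set (MvPolynomial (Fin (r + 1)) ℂ), ∀ u,
      u ∈ orbitClosure p k b ↔ ∀ f ∈ S, MvPolynomial.eval u f = 0 := by
  refine ⟨{f | ∀ u ∈ orbitClosure p k b, MvPolynomial.eval u f = 0}, fun u =>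
    ⟨fun hu f hf => hf u hu, fun hu => ?_⟩⟩
  obtain ⟨t, ht⟩ := exists_param_of_forall_ker (σ := {i : Fin (r + 1) // k ≤ i.val})
    (fun i => p i) (fun i => b i) (i₀ := ⟨⟨k, by omega⟩, le_rfl⟩) (hp _)
    (signedTuples_ne_zero hm hb _) (fun i => u i) (fun f hf => by
      have := hu (MvPolynomial.rename Subtype.val f) (by
        rintro v ⟨t, ht⟩
        rw [MvPolynomial.eval_rename, ← hf t]
        congr 2
        funext i
        exact ht i i.2)
      rwa [MvPolynomial.eval_rename] at this)
  exact ⟨t, fun i hi => ht ⟨i, hi⟩⟩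

/-! ### Counting orbits of signed tuples -/

/-- The coordinatewise action of a tuple of roots of unity on a tuple of complex numbers. -/
def rescale {m : Fin (r + 1) → ℕ} (b : Fin (r + 1) → ℂ) (g : ∀ i, rootsOfUnity (m i) ℂ) :
    Fin (r + 1) → ℂ :=
  fun i => ((g i : ℂˣ) : ℂ) * b i

theorem range_rescale {m : Fin (r + 1) → ℕ} (hm : ∀ i, 0 < m i) {b : Fin (r + 1) → ℂ}
    (hb : b ∈ signedTuples m) : Set.range (rescale (m := m) b) = signedTuples m := by
  ext c
  constructor
  · rintro ⟨g, rfl⟩ i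
    have := (mem_rootsOfUnity' _ _).1 (g i).2
    rw [rescale, mul_pow, hb i, this, one_mul]
  · intro hc
    have hb0 := signedTuples_ne_zero hm hb
    refine ⟨fun i => ⟨Units.mk0 (c i / b i) (div_ne_zero (signedTuples_ne_zero hm hc i) (hb0 i)),
      ?_⟩, ?_⟩
    · rw [mem_rootsOfUnity', Units.val_mk0, div_pow, hc i, hb i, div_self]
      exact pow_ne_zero _ (by norm_num)
    · funext i
      simp [rescale, hb0 i]

/-- Two tuples `g b` and `h b` lie in one orbit, up to the coordinates with index less than `k`, if
and only if `g` and `h` are in the same coset of `monomialSubgroup p m k`. -/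
theorem rescale_mem_orbitClosure_iff {p m : Fin (r + 1) → ℕ} (hp : ∀ i, 0 < p i)
    (hm : ∀ i, 0 < m i) {k : ℕ} (hk : k ≤ r) {b : Fin (r + 1) → ℂ} (hb : b ∈ signedTuples m)
    (g h : ∀ i, rootsOfUnity (m i) ℂ) :
    rescale b h ∈ orbitClosure p k (rescale b g) ↔ g⁻¹ * h ∈ monomialSubgroup p m k := by
  have hb0 := signedTuples_ne_zero hm hb
  constructor
  · rintro ⟨t, ht⟩
    have ht0 : t ≠ 0 := by
      rintro rfl
      have := ht ⟨k, by omega⟩ le_rfl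
      rw [zero_pow (hp _).ne', zero_mul] at this
      exact mul_ne_zero (Units.ne_zero _) (hb0 _) this
    refine ⟨Units.mk0 t ht0, fun i hi => ?_⟩
    have h' := ht i hi
    rw [rescale, rescale, ← mul_assoc] at h'
    have h'' := mul_right_cancel₀ (hb0 i) h'
    change ((g i : ℂˣ))⁻¹ * (h i : ℂˣ) = _
    rw [inv_mul_eq_iff_eq_mul, mul_comm]
    ext
    simpa using h''
  · rintro ⟨t, ht⟩
    refine ⟨t, fun i hi => ?_⟩
    have h' : ((g i : ℂˣ))⁻¹ * (h i : ℂˣ) = t ^ p i := ht i hi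
    rw [inv_mul_eq_iff_eq_mul] at h'
    rw [rescale, rescale, h', Units.val_mul, Units.val_pow_eq_pow_val]
    ring

theorem finite_signedTuples {m : Fin (r + 1) → ℕ} (hm : ∀ i, 0 < m i) :
    (signedTuples m).Finite := by
  have : ∀ i, NeZero (m i) := fun i => ⟨(hm i).ne'⟩
  obtain ⟨b, hb⟩ := signedTuples_nonempty hm
  rw [← range_rescale hm hb]
  exact Set.finite_range _

theorem ncard_image_signedTuples {α : Type} {p m : Fin (r + 1) → ℕ} (hp : ∀ i, 0 < p i)
    (hm : ∀ i, 0 < m i) {k : ℕ} (hk : k ≤ r) {c : (Fin (r + 1) → ℂ) → α}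
    (hc : ∀ b ∈ signedTuples m, ∀ b' ∈ signedTuples m, c b = c b' ↔ b' ∈ orbitClosure p k b) :
    (c '' signedTuples m).ncard = (monomialSubgroup p m k).index := by
  obtain ⟨b, hb⟩ := signedTuples_nonempty hm
  have hmem : ∀ g, rescale (m := m) b g ∈ signedTuples m := fun g =>
    range_rescale hm hb ▸ Set.mem_range_self g
  rw [← range_rescale hm hb, ← Set.range_comp]
  exact ncard_range_of_eq_iff _ _ fun g h => by
    rw [Function.comp_apply, Function.comp_apply, hc _ (hmem g) _ (hmem h),
      rescale_mem_orbitClosure_iff hp hm hk hb]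

theorem ncard_image_fiber {α : Type} {p m : Fin (r + 1) → ℕ} (hp : ∀ i, 0 < p i)
    (hm : ∀ i, 0 < m i) {k l : ℕ} (hk : k ≤ r) (hl : l ≤ r) {c : (Fin (r + 1) → ℂ) → α}
    (hc : ∀ b ∈ signedTuples m, ∀ b' ∈ signedTuples m, c b = c b' ↔ b' ∈ orbitClosure p k b)
    {b : Fin (r + 1) → ℂ} (hb : b ∈ signedTuples m) :
    (c '' {b' ∈ signedTuples m | b' ∈ orbitClosure p l b}).ncard =
      (monomialSubgroup p m k).relIndex (monomialSubgroup p m l) := by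
  have hmem : ∀ g, rescale (m := m) b g ∈ signedTuples m := fun g =>
    range_rescale hm hb ▸ Set.mem_range_self g
  have hone : rescale (m := m) b 1 = b := by
    funext i
    simp [rescale]
  have hset : {b' ∈ signedTuples m | b' ∈ orbitClosure p l b} =
      rescale (m := m) b '' {g | (1 : ∀ i, rootsOfUnity (m i) ℂ)⁻¹ * g ∈
        monomialSubgroup p m l} := by
    ext b'
    constructor
    · rintro ⟨hb', hbb'⟩
      rw [← range_rescale hm hb] at hb'
      obtain ⟨g, rfl⟩ := hb'
      refine ⟨g, ?_, rfl⟩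
      rw [Set.mem_ofPred_eq, ← rescale_mem_orbitClosure_iff hp hm hl hb, hone]
      exact hbb'
    · rintro ⟨g, hg, rfl⟩
      rw [Set.mem_ofPred_eq, ← rescale_mem_orbitClosure_iff hp hm hl hb, hone] at hg
      exact ⟨hmem g, hg⟩
  rw [hset, ← Set.image_comp]
  exact ncard_image_coset_of_eq_iff _ _ _ (fun g h => by
    rw [Function.comp_apply, Function.comp_apply, hc _ (hmem g) _ (hmem h),
      rescale_mem_orbitClosure_iff hp hm hk hb]) 1

/-! ### The Zariski topology of the weighted blow-up -/

theorem isClosed_blowUpPair_iff {p : Fin (r + 1) → ℕ} (Z : Set (BlowUpPair p)) :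
    IsClosed Z ↔ ∃ S : Set (MvPolynomial (Fin (r + 1) ⊕ Fin (r + 1)) ℂ),
      Z = {q | ∀ f ∈ S, MvPolynomial.eval (Sum.elim q.x q.u) f = 0} := by
  let _ := zariskiTopology (Fin (r + 1) ⊕ Fin (r + 1))
  rw [isClosed_induced_iff]
  constructor
  · rintro ⟨T, hT, rfl⟩
    obtain ⟨S, rfl⟩ := (zariskiTopology_isClosed_iff T).1 hT
    exact ⟨S, rfl⟩
  · rintro ⟨S, rfl⟩
    exact ⟨_, (zariskiTopology_isClosed_iff _).2 ⟨S, rfl⟩, rfl⟩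

theorem isClosed_setOf_eval_u {p : Fin (r + 1) → ℕ} (S : Set (MvPolynomial (Fin (r + 1)) ℂ)) :
    IsClosed {q : BlowUpPair p | ∀ f ∈ S, MvPolynomial.eval q.u f = 0} := by
  refine (isClosed_blowUpPair_iff _).2 ⟨MvPolynomial.rename Sum.inr '' S, ?_⟩
  ext q
  simp [MvPolynomial.eval_rename]

theorem isClosed_setOf_x_eq_zero {p : Fin (r + 1) → ℕ} :
    IsClosed {q : BlowUpPair p | q.x = 0} := by
  refine (isClosed_blowUpPair_iff _).2 ⟨Set.range fun i => MvPolynomial.X (Sum.inl i), ?_⟩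
  ext q
  simp [funext_iff]

/-- A set of pairs is irreducible as soon as the polynomials vanishing on it are the kernel of a
ring homomorphism to an integral domain. -/
theorem isIrreducible_of_vanishing_iff {p : Fin (r + 1) → ℕ} {S : Set (BlowUpPair p)}
    (hS : S.Nonempty) {R : Type} [CommRing R] [IsDomain R]
    (φ : MvPolynomial (Fin (r + 1) ⊕ Fin (r + 1)) ℂ →+* R)
    (hφ : ∀ f, (∀ q ∈ S, MvPolynomial.eval (Sum.elim q.x q.u) f = 0) ↔ φ f = 0) :
    IsIrreducible S := by
  refine ⟨hS, isPreirreducible_iff_isClosed_union_isClosed.2 fun Z₁ Z₂ h₁ h₂ h => ?_⟩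
  obtain ⟨S₁, rfl⟩ := (isClosed_blowUpPair_iff Z₁).1 h₁
  obtain ⟨S₂, rfl⟩ := (isClosed_blowUpPair_iff Z₂).1 h₂
  by_contra! hne
  obtain ⟨q₁, hq₁, hn₁⟩ := Set.not_subset.1 hne.1
  obtain ⟨q₂, hq₂, hn₂⟩ := Set.not_subset.1 hne.2
  simp only [Set.mem_ofPred_eq, not_forall] at hn₁ hn₂
  obtain ⟨f₁, hf₁, hv₁⟩ := hn₁
  obtain ⟨f₂, hf₂, hv₂⟩ := hn₂
  have hmul : φ (f₁ * f₂) = 0 := by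
    rw [← hφ]
    intro q hq
    rw [map_mul]
    rcases h hq with h | h
    · rw [h f₁ hf₁, zero_mul]
    · rw [h f₂ hf₂, mul_zero]
  rw [map_mul, mul_eq_zero] at hmul
  rcases hmul with h0 | h0
  · exact hv₁ ((hφ f₁).2 h0 q₁ hq₁)
  · exact hv₂ ((hφ f₂).2 h0 q₂ hq₂)

namespace WeightedBlowUp

variable {d : ℕ} {a : Fin (r + 1) → ℤ} {p : Fin (r + 1) → ℕ}

theorem continuous_mk : Continuous (mk d a p) := continuous_coinduced_rng

theorem isClosed_iff_preimage_mk {T : Set (WeightedBlowUp d a p)} :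
    IsClosed T ↔ IsClosed (mk d a p ⁻¹' T) := isClosed_coinduced

theorem mk_surjective : Function.Surjective (mk d a p) := Quotient.exists_rep

theorem mk_eq_mk_iff {q q' : BlowUpPair p} : mk d a p q = mk d a p q' ↔
    ∃ ξ ∈ rootsOfUnity d ℂ, ∃ t : ℂˣ,
      (∀ i, q'.x i = ((ξ ^ a i : ℂˣ) : ℂ) * q.x i) ∧
      (∀ i, q'.u i = ((t ^ p i * ξ ^ a i : ℂˣ) : ℂ) * q.u i) := Quotient.eq

theorem proj_mk (q : BlowUpPair p) : proj d a p (mk d a p q) = CyclicQuotient.mk d a q.x := rfl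

end WeightedBlowUp

theorem CyclicQuotient.mk_eq_mk_iff {d : ℕ} {a : Fin (r + 1) → ℤ} {x y : Fin (r + 1) → ℂ} :
    mk d a x = mk d a y ↔ ∃ ξ ∈ rootsOfUnity d ℂ, ∀ i, y i = ((ξ ^ a i : ℂˣ) : ℂ) * x i :=
  Quotient.eq

theorem CyclicQuotient.mk_eq_mk_zero_iff {d : ℕ} {a : Fin (r + 1) → ℤ} {x : Fin (r + 1) → ℂ} :
    mk d a x = mk d a 0 ↔ x = 0 := by
  constructor
  · intro h
    obtain ⟨ξ, -, h⟩ := mk_eq_mk_iff.1 h.symm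
    funext i
    simpa using h i
  · rintro rfl
    rfl

/-! ### The equations, their weights, and the action of `μ_d` -/

theorem pow_root_eq {d n : ℕ} {e : ℤ} {ξ : ℂˣ} (hξ : ξ ∈ rootsOfUnity d ℂ)
    (h : (d : ℤ) ∣ e * (n : ℤ)) : ((ξ ^ e : ℂˣ) : ℂ) ^ n = 1 := by
  obtain ⟨c, hc⟩ := h
  rw [← Units.val_pow_eq_pow_val, ← zpow_natCast, ← zpow_mul, hc, zpow_mul, zpow_natCast,
    (mem_rootsOfUnity _ _).1 hξ, one_zpow, Units.val_one]

/-- If `ξ = exp w`, then `s = exp (w * a 1 / p 1)` has `s ^ p i = ξ ^ a i` for all `i ≥ 1`. -/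
theorem exists_pow_eq_zpow {a : Fin (r + 1) → ℤ} {p : Fin (r + 1) → ℕ} (hr : 1 ≤ r)
    (hp : ∀ i, 0 < p i)
    (hweights : ∀ i j : Fin (r + 1), 1 ≤ i.val → 1 ≤ j.val →
      a i * (p j : ℤ) - a j * (p i : ℤ) = 0) (ξ : ℂˣ) :
    ∃ s : ℂ, ∀ i : Fin (r + 1), 1 ≤ i.val → ((ξ ^ a i : ℂˣ) : ℂ) = s ^ p i := by
  have hr' : 1 < r + 1 := by omega
  have hp1 : (p ⟨1, hr'⟩ : ℂ) ≠ 0 := Nat.cast_ne_zero.2 (hp _).ne'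
  refine ⟨Complex.exp (Complex.log ξ * (a ⟨1, hr'⟩ / p ⟨1, hr'⟩)), fun i hi => ?_⟩
  have h : (a i : ℂ) * p ⟨1, hr'⟩ - a ⟨1, hr'⟩ * p i = 0 := by
    exact_mod_cast hweights i ⟨1, hr'⟩ hi le_rfl
  rw [← Complex.exp_nat_mul, Units.val_zpow_eq_zpow_val]
  conv_lhs => rw [← Complex.exp_log ξ.ne_zero]
  rw [← Complex.exp_int_mul]
  congr 1
  field_simp
  linear_combination h * Complex.log ξ

theorem mul_mem_orbitClosure {p : Fin (r + 1) → ℕ} {k : ℕ} {b u v : Fin (r + 1) → ℂ} {s : ℂ}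
    (hu : u ∈ orbitClosure p k b) (hv : ∀ i, k ≤ i.val → v i = s ^ p i * u i) :
    v ∈ orbitClosure p k b := by
  obtain ⟨t, ht⟩ := hu
  exact ⟨s * t, fun i hi => by rw [hv i hi, ht i hi, mul_pow, mul_assoc]⟩

theorem forall_equationsE_iff {m : Fin (r + 1) → ℕ} {u : Fin (r + 1) → ℂ} :
    (∀ f ∈ equationsE m, MvPolynomial.eval u f = 0) ↔
      u 0 ^ m 0 + u 1 ^ m 1 + u 2 ^ m 2 = 0 ∧ SatisfiesChain m 2 u := by
  constructor
  · intro h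
    refine ⟨by simpa using h _ (Or.inl rfl), fun i j hi hj => ?_⟩
    simpa using h _ (Or.inr ⟨i, j, hi, hj, rfl⟩)
  · rintro ⟨h, h'⟩ f (rfl | ⟨i, j, hi, hj, rfl⟩)
    · simpa using h
    · simpa using h' i j hi hj

theorem forall_equationsD_iff {m : Fin (r + 1) → ℕ} (hm : 0 < m 0) {u : Fin (r + 1) → ℂ} :
    (∀ f ∈ equationsD m, MvPolynomial.eval u f = 0) ↔ u 0 = 0 ∧ SatisfiesChain m 1 u := by
  constructor
  · intro h
    refine ⟨by simpa [hm.ne'] using h _ (Or.inl rfl), fun i j hi hj => ?_⟩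
    simpa using h _ (Or.inr ⟨i, j, hi, hj, rfl⟩)
  · rintro ⟨h, h'⟩ f (rfl | ⟨i, j, hi, hj, rfl⟩)
    · simp [h, hm.ne']
    · simpa using h' i j hi hj

/-- All the powers `x_i ^ m i` have the same weighted degree. -/
theorem exists_common_degree {p m : Fin (r + 1) → ℕ} (hr : 2 ≤ r) (hm : ∀ i, 0 < m i)
    (hhom : ∀ f ∈ equationsE m, ∃ n : ℕ, MvPolynomial.IsWeightedHomogeneous p f n) :
    ∃ N, ∀ i, p i * m i = N := by
  classical
  have hv1 := fin_val_one hr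
  have hv2 := fin_val_two hr
  have h01 : (0 : Fin (r + 1)) ≠ 1 := Fin.ne_of_val_ne (by rw [hv1, Fin.val_zero]; decide)
  have h02 : (0 : Fin (r + 1)) ≠ 2 := Fin.ne_of_val_ne (by rw [hv2, Fin.val_zero]; decide)
  have h12 : (1 : Fin (r + 1)) ≠ 2 := Fin.ne_of_val_ne (by rw [hv1, hv2]; decide)
  have hsingle : ∀ i j, i ≠ j → Finsupp.single i (m i) ≠ Finsupp.single j (m j) := by
    intro i j hij h
    rcases (Finsupp.single_eq_single_iff _ _ _ _).1 h with h | h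
    · exact hij h.1
    · exact (hm i).ne' h.1
  have hweight : ∀ i, Finsupp.weight p (Finsupp.single i (m i)) = p i * m i := by
    intro i
    rw [Finsupp.weight_single, smul_eq_mul, mul_comm]
  obtain ⟨N, hN⟩ := hhom _ (Or.inl rfl)
  have hN0 : p 0 * m 0 = N := by
    rw [← hweight]
    apply hN
    simp [MvPolynomial.coeff_X_pow, hsingle _ _ h01.symm, hsingle _ _ h02.symm]
  have hN1 : p 1 * m 1 = N := by
    rw [← hweight]
    apply hN
    simp [MvPolynomial.coeff_X_pow, hsingle _ _ h01, hsingle _ _ h12.symm]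
  have hN2 : p 2 * m 2 = N := by
    rw [← hweight]
    apply hN
    simp [MvPolynomial.coeff_X_pow, hsingle _ _ h02, hsingle _ _ h12]
  have hstep : ∀ i j : Fin (r + 1), 2 ≤ i.val → j.val = i.val + 1 → p j * m j = p i * m i := by
    intro i j hi hj
    have hij : i ≠ j := fun h => by simp [h] at hj
    obtain ⟨n, hn⟩ := hhom _ (Or.inr ⟨i, j, hi, hj, rfl⟩)
    rw [← hweight, ← hweight, hn, hn]
    · simp [MvPolynomial.coeff_X_pow, hsingle _ _ hij.symm]
    · simp [MvPolynomial.coeff_X_pow, hsingle _ _ hij]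
  have key : ∀ n (hn : n < r + 1), 2 ≤ n → p ⟨n, hn⟩ * m ⟨n, hn⟩ = N := by
    intro n hn h2n
    induction n, h2n using Nat.le_induction with
    | base => rwa [show (⟨2, hn⟩ : Fin (r + 1)) = 2 from Fin.ext hv2.symm]
    | succ n h2n ih => rw [hstep ⟨n, by omega⟩ ⟨n + 1, hn⟩ h2n rfl, ih]
  refine ⟨N, fun i => ?_⟩
  rcases i with ⟨_ | _ | n, hi⟩
  · exact hN0
  · rwa [show (⟨0 + 1, hi⟩ : Fin (r + 1)) = 1 from Fin.ext hv1.symm]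
  · exact key _ hi (by omega)

/-! ### The irreducible closed sets of pairs -/

/-- The point `(s · b', b')` of the blow-up, where `b'` is `b` with its zeroth coordinate replaced
by `0`. -/
def curvePoint (p : Fin (r + 1) → ℕ) (hr : 2 ≤ r) {b : Fin (r + 1) → ℂ} (hb : ∀ i, b i ≠ 0)
    (s : ℂ) : BlowUpPair p where
  x i := s ^ p i * Function.update b 0 0 i
  u := Function.update b 0 0
  u_ne_zero h := hb 1 <| by
    have h01 : (1 : Fin (r + 1)) ≠ 0 :=
      Fin.ne_of_val_ne (by rw [fin_val_one hr, Fin.val_zero]; decide)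
    simpa [h01] using congrFun h 1
  mem_closure := ⟨s, fun _ => rfl⟩

theorem update_zero_apply_of_pos (b : Fin (r + 1) → ℂ) {i : Fin (r + 1)} (hi : 1 ≤ i.val) :
    Function.update b 0 0 i = b i :=
  Function.update_of_ne (Fin.ne_of_val_ne (by rw [Fin.val_zero]; omega)) _ _

theorem update_zero_mem_orbitClosure (p : Fin (r + 1) → ℕ) {k : ℕ} (hk : 1 ≤ k)
    (b : Fin (r + 1) → ℂ) : Function.update b 0 0 ∈ orbitClosure p k b :=
  ⟨1, fun i hi => by rw [update_zero_apply_of_pos b (hk.trans hi), one_pow, one_mul]⟩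

/-- The points `(x, u)` with `u` in the `ℂ*`-orbit of `(0, b 1, …, b r)`. -/
def divisorPairs (p : Fin (r + 1) → ℕ) (b : Fin (r + 1) → ℂ) : Set (BlowUpPair p) :=
  {q | q.u 0 = 0 ∧ q.u ∈ orbitClosure p 1 b}

/-- The points `(0, u)` for which `(u 2, …, u r)` lies in the closure of the `ℂ*`-orbit of
`(b 2, …, b r)` and the first equation of `ℰ` holds. -/
def exceptionalPairs (p m : Fin (r + 1) → ℕ) (b : Fin (r + 1) → ℂ) : Set (BlowUpPair p) :=
  {q | q.x = 0 ∧ q.u ∈ orbitClosure p 2 b ∧ q.u 0 ^ m 0 + q.u 1 ^ m 1 + q.u 2 ^ m 2 = 0}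

section Pairs

variable {p m : Fin (r + 1) → ℕ} {b b' : Fin (r + 1) → ℂ}

theorem isClosed_divisorPairs (hr : 2 ≤ r) (hp : ∀ i, 0 < p i) (hm : ∀ i, 0 < m i)
    (hb : b ∈ signedTuples m) : IsClosed (divisorPairs p b) := by
  obtain ⟨S, hS⟩ := exists_equations_orbitClosure hp hm (k := 1) (by omega) hb
  have : divisorPairs p b = {q | ∀ f ∈ ({MvPolynomial.X 0} : Set (MvPolynomial _ ℂ)),
      MvPolynomial.eval q.u f = 0} ∩ {q | ∀ f ∈ S, MvPolynomial.eval q.u f = 0} := by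
    ext q
    simp [divisorPairs, hS]
  rw [this]
  exact (isClosed_setOf_eval_u _).inter (isClosed_setOf_eval_u _)

theorem isClosed_exceptionalPairs (hr : 2 ≤ r) (hp : ∀ i, 0 < p i) (hm : ∀ i, 0 < m i)
    (hb : b ∈ signedTuples m) : IsClosed (exceptionalPairs p m b) := by
  obtain ⟨S, hS⟩ := exists_equations_orbitClosure hp hm (k := 2) hr hb
  have : exceptionalPairs p m b = {q | q.x = 0} ∩ ({q | ∀ f ∈ S, MvPolynomial.eval q.u f = 0} ∩
      {q | ∀ f ∈ ({MvPolynomial.X 0 ^ m 0 + MvPolynomial.X 1 ^ m 1 + MvPolynomial.X 2 ^ m 2} :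
        Set (MvPolynomial _ ℂ)), MvPolynomial.eval q.u f = 0}) := by
    ext q
    simp [exceptionalPairs, hS]
  rw [this]
  exact isClosed_setOf_x_eq_zero.inter ((isClosed_setOf_eval_u _).inter (isClosed_setOf_eval_u _))

theorem exists_ne_zero_of_mem_divisorPairs (hp : ∀ i, 0 < p i) {q : BlowUpPair p}
    (hq : q ∈ divisorPairs p b) :
    ∃ t : ℂ, t ≠ 0 ∧ ∀ i, q.u i = t ^ p i * Function.update b 0 0 i := by
  obtain ⟨h0, t, ht⟩ := hq
  have key : ∀ i, q.u i = t ^ p i * Function.update b 0 0 i := by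
    intro i
    by_cases hi : i = 0
    · subst hi
      simpa using h0
    · rw [Function.update_of_ne hi]
      exact ht i (Nat.one_le_iff_ne_zero.2 fun h => hi (Fin.ext h))
  refine ⟨t, ?_, key⟩
  rintro rfl
  apply q.u_ne_zero
  funext i
  rw [key, zero_pow (hp i).ne', zero_mul, Pi.zero_apply]

theorem curvePoint_mem_divisorPairs (hr : 2 ≤ r) (hb : ∀ i, b i ≠ 0) (s : ℂ) :
    curvePoint p hr hb s ∈ divisorPairs p b :=
  ⟨by simp [curvePoint], update_zero_mem_orbitClosure p le_rfl b⟩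

theorem curvePoint_zero_mem_exceptionalPairs (hr : 2 ≤ r) (hp : ∀ i, 0 < p i)
    (hm : ∀ i, 0 < m i) (hb : b ∈ signedTuples m) :
    curvePoint p hr (signedTuples_ne_zero hm hb) 0 ∈ exceptionalPairs p m b := by
  refine ⟨?_, update_zero_mem_orbitClosure p one_le_two b, ?_⟩
  · funext i
    simp [curvePoint, (hp i).ne']
  · have h1 := fin_val_one hr
    have h2 := fin_val_two hr
    change Function.update b 0 0 0 ^ m 0 + Function.update b 0 0 1 ^ m 1 +
      Function.update b 0 0 2 ^ m 2 = 0
    rw [update_zero_apply_of_pos b (i := 1) (by omega),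
      update_zero_apply_of_pos b (i := 2) (by omega), hb 1, hb 2, h1, h2, Function.update_self,
      zero_pow (hm 0).ne']
    norm_num

/-- The restriction of polynomials to the curve `s ↦ curvePoint p hr hb s`. -/
theorem exists_curvePoint_algHom (hr : 2 ≤ r) (hb : ∀ i, b i ≠ 0) :
    ∃ φ : MvPolynomial (Fin (r + 1) ⊕ Fin (r + 1)) ℂ →ₐ[ℂ] Polynomial ℂ,
      ∀ f s, Polynomial.eval s (φ f) =
        MvPolynomial.eval (Sum.elim (curvePoint p hr hb s).x (curvePoint p hr hb s).u) f := by
  let φ : MvPolynomial (Fin (r + 1) ⊕ Fin (r + 1)) ℂ →ₐ[ℂ] Polynomial ℂ :=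
    MvPolynomial.aeval (Sum.elim
      (fun i => Polynomial.X ^ p i * Polynomial.C (Function.update b 0 0 i))
      (fun i => Polynomial.C (Function.update b 0 0 i)))
  refine ⟨φ, fun f s => ?_⟩
  have h : (Polynomial.aeval s).comp φ = MvPolynomial.aeval
      (Sum.elim (curvePoint p hr hb s).x (curvePoint p hr hb s).u) := by
    ext i
    rcases i with i | i <;>
      simp only [φ, AlgHom.comp_apply, MvPolynomial.aeval_X, Sum.elim_inl, Sum.elim_inr, map_mul,
        map_pow, Polynomial.aeval_X, Polynomial.aeval_C, Algebra.algebraMap_self,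
        RingHom.id_apply, curvePoint]
  simpa [MvPolynomial.aeval_eq_eval, Polynomial.coe_aeval_eq_eval] using DFunLike.congr_fun h f

theorem isIrreducible_range_curvePoint (hr : 2 ≤ r) (hb : ∀ i, b i ≠ 0) :
    IsIrreducible (Set.range (curvePoint p hr hb)) := by
  obtain ⟨φ, hφ⟩ := exists_curvePoint_algHom (p := p) hr hb
  refine isIrreducible_of_vanishing_iff (Set.range_nonempty _) φ.toRingHom fun f => ?_
  rw [Set.forall_mem_range]
  change _ ↔ φ f = 0
  simp_rw [← hφ]
  exact ⟨fun h => Polynomial.funext fun s => (h s).trans Polynomial.eval_zero.symm,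
    fun h s => by rw [h, Polynomial.eval_zero]⟩

/-- A closed set containing the points of the curve with `s ≠ 0` contains the one with `s = 0`. -/
theorem curvePoint_mem_of_isClosed (hr : 2 ≤ r) (hb : ∀ i, b i ≠ 0)
    {Z : Set (BlowUpPair p)} (hZ : IsClosed Z) (h : ∀ s ≠ 0, curvePoint p hr hb s ∈ Z) (s : ℂ) :
    curvePoint p hr hb s ∈ Z := by
  obtain ⟨S, rfl⟩ := (isClosed_blowUpPair_iff Z).1 hZ
  obtain ⟨φ, hφ⟩ := exists_curvePoint_algHom (p := p) hr hb
  intro f hf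
  have h0 : φ f = 0 := by
    refine Polynomial.eq_zero_of_infinite_isRoot _
      (((Set.finite_singleton (0 : ℂ)).infinite_compl).mono fun s hs => ?_)
    rw [Set.mem_ofPred_eq, Polynomial.IsRoot, hφ]
    exact h s hs f hf
  rw [← hφ, h0, Polynomial.eval_zero]

/-- The point `(y 0, y 1, y 2 ^ p 2 * b 2, …, y 2 ^ p r * b r)` of `ℂ^(r+1)`. -/
def surfaceVector (p : Fin (r + 1) → ℕ) (b : Fin (r + 1) → ℂ) (y : Fin 3 → ℂ) (i : Fin (r + 1)) :
    ℂ :=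
  if i.val = 0 then y 0 else if i.val = 1 then y 1 else y 2 ^ p i * b i

theorem surfaceVector_of_two_le (y : Fin 3 → ℂ) {i : Fin (r + 1)} (hi : 2 ≤ i.val) :
    surfaceVector p b y i = y 2 ^ p i * b i := by
  rw [surfaceVector, if_neg (by omega), if_neg (by omega)]

theorem surfaceVector_equation (hr : 2 ≤ r) (hpm : p 2 * m 2 = p 1 * m 1) (hb : b ∈ signedTuples m)
    (y : Fin 3 → ℂ) :
    surfaceVector p b y 0 ^ m 0 + surfaceVector p b y 1 ^ m 1 + surfaceVector p b y 2 ^ m 2 =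
      y 0 ^ m 0 + y 1 ^ m 1 + y 2 ^ (p 1 * m 1) := by
  have hv2 := fin_val_two hr
  rw [surfaceVector_of_two_le y hv2.ge, mul_pow, hb 2, hv2, ← pow_mul, hpm, surfaceVector,
    if_pos (Fin.val_zero _), surfaceVector, fin_val_one hr, if_neg one_ne_zero, if_pos rfl]
  norm_num

theorem eq_surfaceVector (hr : 2 ≤ r) {u : Fin (r + 1) → ℂ} {t : ℂ}
    (ht : ∀ i, 2 ≤ i.val → u i = t ^ p i * b i) : u = surfaceVector p b ![u 0, u 1, t] := by
  funext i
  by_cases hi0 : i.val = 0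
  · rw [surfaceVector, if_pos hi0, show i = 0 from Fin.ext hi0, Matrix.cons_val_zero]
  by_cases hi1 : i.val = 1
  · rw [surfaceVector, if_neg hi0, if_pos hi1,
      show i = 1 from Fin.ext (hi1.trans (fin_val_one hr).symm), Matrix.cons_val_one,
      Matrix.cons_val_zero]
  · rw [surfaceVector_of_two_le _ (by omega), ht i (by omega)]
    rfl

/-- The restriction of polynomials to the points `(0, surfaceVector p b y)`. -/
theorem exists_surfaceVector_algHom (p : Fin (r + 1) → ℕ) (b : Fin (r + 1) → ℂ) :
    ∃ φ : MvPolynomial (Fin (r + 1) ⊕ Fin (r + 1)) ℂ →ₐ[ℂ] MvPolynomial (Fin 3) ℂ,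
      ∀ f y, MvPolynomial.eval y (φ f) =
        MvPolynomial.eval (Sum.elim 0 (surfaceVector p b y)) f := by
  let φ : MvPolynomial (Fin (r + 1) ⊕ Fin (r + 1)) ℂ →ₐ[ℂ] MvPolynomial (Fin 3) ℂ :=
    MvPolynomial.aeval (Sum.elim (fun _ => 0) fun i => if i.val = 0 then MvPolynomial.X 0 else
      if i.val = 1 then MvPolynomial.X 1 else MvPolynomial.X 2 ^ p i * MvPolynomial.C (b i))
  refine ⟨φ, fun f y => ?_⟩
  have h : (MvPolynomial.aeval y).comp φ =
      MvPolynomial.aeval (Sum.elim 0 (surfaceVector p b y)) := by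
    ext i
    rcases i with i | i
    · simp [φ]
    · simp only [φ, surfaceVector, AlgHom.comp_apply, MvPolynomial.aeval_X, Sum.elim_inr]
      split_ifs <;> simp
  simpa [MvPolynomial.aeval_eq_eval] using DFunLike.congr_fun h f

/-- The set of exceptional pairs is the image of the surface `x ^ m 0 + y ^ m 1 + s ^ N = 0` without
the origin, where `N = p 1 * m 1`; this surface is irreducible. -/
theorem isIrreducible_exceptionalPairs (hr : 2 ≤ r) (hp : ∀ i, 0 < p i) (hm : ∀ i, 0 < m i)
    (hpm : p 2 * m 2 = p 1 * m 1) (hb : b ∈ signedTuples m) :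
    IsIrreducible (exceptionalPairs p m b) := by
  have hv2 := fin_val_two hr
  obtain ⟨F, hF⟩ : ∃ F : MvPolynomial (Fin 3) ℂ, F =
    MvPolynomial.X 0 ^ m 0 + MvPolynomial.X 1 ^ m 1 + MvPolynomial.X 2 ^ (p 1 * m 1) := ⟨_, rfl⟩
  have hprime : Prime F := by
    rw [hF]
    exact prime_surface (hm 0) (hm 1)
  have hI : (Ideal.span {F}).IsPrime := (Ideal.span_singleton_prime hprime.ne_zero).2 hprime
  obtain ⟨φ, hφ⟩ := exists_surfaceVector_algHom p b
  have := Ideal.Quotient.isDomain (Ideal.span {F})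
  refine isIrreducible_of_vanishing_iff
    ⟨_, curvePoint_zero_mem_exceptionalPairs hr hp hm hb⟩
    ((Ideal.Quotient.mk (Ideal.span {F})).comp φ.toRingHom) fun f => ?_
  have hker : ((Ideal.Quotient.mk (Ideal.span {F})).comp φ.toRingHom) f = 0 ↔ F ∣ φ f := by
    rw [← Ideal.mem_span_singleton, ← Ideal.Quotient.eq_zero_iff_mem]
    rfl
  rw [hker]
  constructor
  · intro h
    rw [hF]
    refine surface_dvd_of_vanishing (hm 0) (hm 1) fun y hy2 hy => ?_
    rw [hφ]
    refine h ⟨0, surfaceVector p b y, fun h0 => ?_, 0, fun i => ?_⟩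
      ⟨rfl, ⟨y 2, fun i => surfaceVector_of_two_le y⟩, ?_⟩
    · have := congrFun h0 2
      rw [surfaceVector_of_two_le y hv2.ge] at this
      exact mul_ne_zero (pow_ne_zero _ hy2) (signedTuples_ne_zero hm hb 2) this
    · rw [zero_pow (hp i).ne', zero_mul, Pi.zero_apply]
    · exact (surfaceVector_equation hr hpm hb y).trans hy
  · rintro h q ⟨hx, ⟨t, ht⟩, hq⟩
    have hqv := eq_surfaceVector hr ht
    rw [hx, hqv, ← hφ]
    obtain ⟨g, hg⟩ := h
    have hF0 : MvPolynomial.eval ![q.u 0, q.u 1, t] F = 0 := by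
      rw [hqv, surfaceVector_equation hr hpm hb] at hq
      simpa [hF] using hq
    rw [hg, map_mul, hF0, zero_mul]

end Pairs

/-! ### Images in the blow-up of the quotient -/

namespace WeightedBlowUp

variable {d : ℕ} {a : Fin (r + 1) → ℤ} {p m : Fin (r + 1) → ℕ}

/-- By the proportionality of the weights, `μ_d` acts on the coordinates of positive index through
`ℂ*`, so it preserves the orbit closures. -/
theorem mem_orbitClosure_of_mk_eq (hr : 1 ≤ r) (hp : ∀ i, 0 < p i)
    (hweights : ∀ i j : Fin (r + 1), 1 ≤ i.val → 1 ≤ j.val →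
      a i * (p j : ℤ) - a j * (p i : ℤ) = 0)
    {k : ℕ} (hk : 1 ≤ k) {b : Fin (r + 1) → ℂ} {q q' : BlowUpPair p}
    (h : mk d a p q = mk d a p q') (hq : q.u ∈ orbitClosure p k b) :
    q'.u ∈ orbitClosure p k b := by
  obtain ⟨ξ, -, t, -, hu⟩ := mk_eq_mk_iff.1 h
  obtain ⟨s, hs⟩ := exists_pow_eq_zpow hr hp hweights ξ
  refine mul_mem_orbitClosure (s := t * s) hq fun i hi => ?_
  rw [hu i, Units.val_mul, hs i (hk.trans hi), Units.val_pow_eq_pow_val, mul_pow]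

theorem preimage_image_divisorPairs (hr : 1 ≤ r) (hp : ∀ i, 0 < p i)
    (hweights : ∀ i j : Fin (r + 1), 1 ≤ i.val → 1 ≤ j.val →
      a i * (p j : ℤ) - a j * (p i : ℤ) = 0) (b : Fin (r + 1) → ℂ) :
    mk d a p ⁻¹' (mk d a p '' divisorPairs p b) = divisorPairs p b := by
  refine (Set.subset_preimage_image _ _).antisymm' ?_
  rintro q ⟨q', ⟨h0, hu⟩, h⟩
  refine ⟨?_, mem_orbitClosure_of_mk_eq hr hp hweights le_rfl h hu⟩
  obtain ⟨ξ, -, t, -, hu'⟩ := mk_eq_mk_iff.1 h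
  rw [hu' 0, h0, mul_zero]

theorem x_eq_zero_of_mk_eq {q q' : BlowUpPair p} (h : mk d a p q = mk d a p q')
    (hq : q.x = 0) : q'.x = 0 := by
  obtain ⟨ξ, -, t, hx, -⟩ := mk_eq_mk_iff.1 h
  funext i
  rw [hx i, hq, Pi.zero_apply, mul_zero]

theorem preimage_image_exceptionalPairs (hr : 1 ≤ r) (hp : ∀ i, 0 < p i) {N : ℕ}
    (hN : ∀ i, p i * m i = N) (hdvd : ∀ i, (d : ℤ) ∣ a i * (m i : ℤ))
    (hweights : ∀ i j : Fin (r + 1), 1 ≤ i.val → 1 ≤ j.val →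
      a i * (p j : ℤ) - a j * (p i : ℤ) = 0) (b : Fin (r + 1) → ℂ) :
    mk d a p ⁻¹' (mk d a p '' exceptionalPairs p m b) = exceptionalPairs p m b := by
  refine (Set.subset_preimage_image _ _).antisymm' ?_
  rintro q ⟨q', ⟨hx, hu, he⟩, h⟩
  refine ⟨x_eq_zero_of_mk_eq h hx, mem_orbitClosure_of_mk_eq hr hp hweights one_le_two h hu, ?_⟩
  obtain ⟨ξ, hξ, t, -, hu'⟩ := mk_eq_mk_iff.1 h
  have hpow : ∀ i, q.u i ^ m i = (t : ℂ) ^ N * q'.u i ^ m i := by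
    intro i
    rw [hu' i, mul_pow, Units.val_mul, mul_pow, pow_root_eq hξ (hdvd i), mul_one,
      Units.val_pow_eq_pow_val, ← pow_mul, hN]
  rw [hpow, hpow, hpow, ← mul_add, ← mul_add, he, mul_zero]

theorem mk_eq_mk_curvePoint (hr : 2 ≤ r) (hp : ∀ i, 0 < p i) {b : Fin (r + 1) → ℂ}
    (hb : ∀ i, b i ≠ 0) {q : BlowUpPair p} (hq : q ∈ divisorPairs p b) :
    ∃ s : ℂ, mk d a p (curvePoint p hr hb s) = mk d a p q ∧ (q.x = 0 → s = 0) := by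
  obtain ⟨t, ht0, ht⟩ := exists_ne_zero_of_mem_divisorPairs hp hq
  obtain ⟨s, hs⟩ := q.mem_closure
  have hx : ∀ i, q.x i = (s * t) ^ p i * Function.update b 0 0 i := by
    intro i
    rw [hs i, ht i, mul_pow, mul_assoc]
  refine ⟨s * t, mk_eq_mk_iff.2 ⟨1, one_mem _, Units.mk0 t ht0, fun i => ?_, fun i => ?_⟩,
    fun h0 => ?_⟩
  · simpa [curvePoint] using hx i
  · simpa [curvePoint] using ht i
  · have h1 := hx 1
    rw [h0, update_zero_apply_of_pos b (fin_val_one hr).ge, Pi.zero_apply, eq_comm,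
      mul_eq_zero] at h1
    exact eq_zero_of_pow_eq_zero (h1.resolve_right (hb 1))

theorem image_divisorPairs (hr : 2 ≤ r) (hp : ∀ i, 0 < p i) {b : Fin (r + 1) → ℂ}
    (hb : ∀ i, b i ≠ 0) :
    mk d a p '' divisorPairs p b = mk d a p '' Set.range (curvePoint p hr hb) := by
  apply Set.Subset.antisymm
  · rintro _ ⟨q, hq, rfl⟩
    obtain ⟨s, hs, -⟩ := mk_eq_mk_curvePoint (d := d) (a := a) hr hp hb hq
    exact ⟨_, ⟨s, rfl⟩, hs⟩
  · exact Set.image_mono (Set.range_subset_iff.2 (curvePoint_mem_divisorPairs hr hb))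

/-- The equations of `D` are invariant under `μ_d`, so they may be checked on any representative. -/
theorem mk_mem_preimage_locus_iff (hm : ∀ i, 0 < m i)
    (hdvd : ∀ i, (d : ℤ) ∣ a i * (m i : ℤ)) {q : BlowUpPair p} :
    mk d a p q ∈ proj d a p ⁻¹' (CyclicQuotient.locus d a (equationsD m) \
      {CyclicQuotient.mk d a 0}) ↔ q.x ≠ 0 ∧ q.x 0 = 0 ∧ SatisfiesChain m 1 q.x := by
  rw [Set.mem_preimage, proj_mk, Set.mem_sdiff, Set.mem_singleton_iff,
    CyclicQuotient.mk_eq_mk_zero_iff, and_comm, and_congr_right_iff]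
  intro _
  constructor
  · rintro ⟨y, hy, hy'⟩
    obtain ⟨h0, hc⟩ := (forall_equationsD_iff (hm 0)).1 hy'
    obtain ⟨ξ, hξ, h⟩ := CyclicQuotient.mk_eq_mk_iff.1 hy.symm
    have hpow : ∀ i, q.x i ^ m i = y i ^ m i := by
      intro i
      rw [h i, mul_pow, pow_root_eq hξ (hdvd i), one_mul]
    refine ⟨by rw [h 0, h0, mul_zero], fun i j hi hj => ?_⟩
    rw [hpow, hpow]
    exact hc i j hi hj
  · intro h
    exact ⟨q.x, rfl, (forall_equationsD_iff (hm 0)).2 h⟩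

/-- The curves on the right are closed and cover `π⁻¹(D \ 0)`; conversely the point of each of them
on the exceptional divisor lies in the closure of the others. -/
theorem strictTransform_eq_iUnion (hr : 2 ≤ r) (hp : ∀ i, 0 < p i) (hm : ∀ i, 0 < m i) {N : ℕ}
    (hN : ∀ i, p i * m i = N) (hdvd : ∀ i, (d : ℤ) ∣ a i * (m i : ℤ))
    (hclosed : ∀ b ∈ signedTuples m, IsClosed (mk d a p '' divisorPairs p b)) :
    strictTransform d a p (CyclicQuotient.locus d a (equationsD m)) =
      ⋃ b ∈ signedTuples m, mk d a p '' divisorPairs p b := by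
  apply Set.Subset.antisymm
  · refine closure_minimal ?_ ((finite_signedTuples hm).isClosed_biUnion hclosed)
    intro P hP
    obtain ⟨q, rfl⟩ := mk_surjective P
    obtain ⟨hx, h0, hc⟩ := (mk_mem_preimage_locus_iff hm hdvd).1 hP
    obtain ⟨b, hb, t, ht⟩ := exists_mem_orbitClosure_of_satisfiesChain hp hm hN (by omega) hc
    obtain ⟨s, hs⟩ := q.mem_closure
    have hs0 : s ≠ 0 := by
      rintro rfl
      apply hx
      funext i
      rw [hs i, zero_pow (hp i).ne', zero_mul, Pi.zero_apply]
    refine Set.mem_biUnion hb ⟨q, ⟨?_, t / s, fun i hi => ?_⟩, rfl⟩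
    · rw [hs 0, mul_eq_zero] at h0
      exact h0.resolve_left (pow_ne_zero _ hs0)
    · rw [div_pow, div_mul_eq_mul_div, ← ht i hi, hs i, mul_div_cancel_left₀]
      exact pow_ne_zero _ hs0
  · refine Set.iUnion₂_subset fun b hb => ?_
    have hb0 := signedTuples_ne_zero hm hb
    rw [image_divisorPairs hr hp hb0]
    rintro _ ⟨_, ⟨s, rfl⟩, rfl⟩
    refine curvePoint_mem_of_isClosed hr hb0 (isClosed_closure.preimage continuous_mk)
      (fun s hs => subset_closure ((mk_mem_preimage_locus_iff hm hdvd).2 ⟨?_, ?_, ?_⟩)) s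
    · intro h
      have h1 := congrFun h 1
      have h1' : (curvePoint p hr hb0 s).x 1 = s ^ p 1 * b 1 := by
        rw [← update_zero_apply_of_pos b (fin_val_one hr).ge]
        rfl
      rw [h1'] at h1
      exact mul_ne_zero (pow_ne_zero _ hs) (hb0 1) h1
    · simp [curvePoint]
    · exact satisfiesChain_of_mem_orbitClosure hN hb
        (mul_mem_orbitClosure (update_zero_mem_orbitClosure p le_rfl b) fun i _ => rfl)

theorem exceptionalLocus_eq_iUnion (hr : 2 ≤ r) (hp : ∀ i, 0 < p i) (hm : ∀ i, 0 < m i) {N : ℕ}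
    (hN : ∀ i, p i * m i = N) :
    exceptionalLocus d a p (equationsE m) =
      ⋃ b ∈ signedTuples m, mk d a p '' exceptionalPairs p m b := by
  apply Set.Subset.antisymm
  · rintro _ ⟨hP, q, rfl, hq⟩
    have hx : q.x = 0 := CyclicQuotient.mk_eq_mk_zero_iff.1 hP
    obtain ⟨he, hc⟩ := forall_equationsE_iff.1 hq
    obtain ⟨b, hb, hu⟩ := exists_mem_orbitClosure_of_satisfiesChain hp hm hN hr hc
    exact Set.mem_biUnion hb ⟨q, ⟨hx, hu, he⟩, rfl⟩
  · refine Set.iUnion₂_subset fun b hb => ?_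
    rintro _ ⟨q, ⟨hx, hu, he⟩, rfl⟩
    exact ⟨CyclicQuotient.mk_eq_mk_zero_iff.2 hx, q, rfl,
      forall_equationsE_iff.2 ⟨he, satisfiesChain_of_mem_orbitClosure hN hb hu⟩⟩

end WeightedBlowUp

/-! ### Components of the strict transform and of the exceptional curve -/

open WeightedBlowUp in
theorem mainTheorem8 (r : ℕ) (hr : 2 ≤ r) (d : ℕ) (hd : 0 < d)
    (a : Fin (r + 1) → ℤ) (p m : Fin (r + 1) → ℕ)
    (hp : ∀ i, 0 < p i) (hm : ∀ i, 0 < m i)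
    (hdvd : ∀ i, (d : ℤ) ∣ a i * (m i : ℤ))
    (hhom : ∀ f ∈ equationsE m, ∃ n : ℕ, MvPolynomial.IsWeightedHomogeneous p f n)
    (hweights : ∀ i j : Fin (r + 1), 1 ≤ i.val → 1 ≤ j.val →
      a i * (p j : ℤ) - a j * (p i : ℤ) = 0)
    (E : Set (WeightedBlowUp d a p))
    (hE : E = WeightedBlowUp.exceptionalLocus d a p (equationsE m))
    (A : WeightedBlowUp d a p)
    (hA : ∀ i : Fin (r + 1), 2 ≤ i.val →
      E ∩ WeightedBlowUp.exceptionalLocus d a p {MvPolynomial.X i} = {A})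
    (D : Set (WeightedBlowUp d a p))
    (hD : D = WeightedBlowUp.strictTransform d a p (CyclicQuotient.locus d a (equationsD m))) :
    ((componentsOf D).encard = ((prodFrom m 1 / lcmFrom m 1 : ℕ) : ℕ∞) ∧
      (componentsOf D).PairwiseDisjoint id) ∧
    (∀ C ∈ componentsOf D, ∃ F ∈ componentsOf E,
      (∃ P, C ∩ F = {P}) ∧ ∀ F' ∈ componentsOf E, (C ∩ F').Nonempty → F' = F) ∧
    ((∀ F ∈ componentsOf E,
      {C ∈ componentsOf D | (C ∩ F).Nonempty}.encard =
        ((m 1 * lcmFrom m 2 / lcmFrom m 1 : ℕ) : ℕ∞)) ∧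
      ((m 1 * lcmFrom m 2 / lcmFrom m 1 : ℕ) : ℚ) =
        ((componentsOf D).ncard : ℚ) / ((componentsOf E).ncard : ℚ)) := by
  obtain ⟨N, hN⟩ := exists_common_degree hr hm hhom
  have hr1 : 1 ≤ r := by omega
  set S := signedTuples m with hS
  have hS0 : ∀ b ∈ S, ∀ i, b i ≠ 0 := fun b hb => signedTuples_ne_zero hm hb
  set c : (Fin (r + 1) → ℂ) → Set (WeightedBlowUp d a p) :=
    fun b => mk d a p '' divisorPairs p b with hc
  set e : (Fin (r + 1) → ℂ) → Set (WeightedBlowUp d a p) :=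
    fun b => mk d a p '' exceptionalPairs p m b with he
  have hcpre : ∀ b, mk d a p ⁻¹' c b = divisorPairs p b :=
    preimage_image_divisorPairs hr1 hp hweights
  have hepre : ∀ b, mk d a p ⁻¹' e b = exceptionalPairs p m b :=
    preimage_image_exceptionalPairs hr1 hp hN hdvd hweights
  have hcmem : ∀ b q, mk d a p q ∈ c b ↔ q ∈ divisorPairs p b := fun b q => by
    rw [← hcpre b, Set.mem_preimage]
  have hemem : ∀ b q, mk d a p q ∈ e b ↔ q ∈ exceptionalPairs p m b := fun b q => by
    rw [← hepre b, Set.mem_preimage]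
  have hcclosed : ∀ b ∈ S, IsClosed (c b) := fun b hb => by
    rw [isClosed_iff_preimage_mk, hcpre]
    exact isClosed_divisorPairs hr hp hm hb
  have heclosed : ∀ b ∈ S, IsClosed (e b) := fun b hb => by
    rw [isClosed_iff_preimage_mk, hepre]
    exact isClosed_exceptionalPairs hr hp hm hb
  have hcirr : ∀ b ∈ S, IsIrreducible (c b) := fun b hb => by
    rw [hc]
    dsimp only
    rw [image_divisorPairs hr hp (hS0 b hb)]
    exact (isIrreducible_range_curvePoint hr (hS0 b hb)).image _ continuous_mk.continuousOn
  have heirr : ∀ b ∈ S, IsIrreducible (e b) := fun b hb =>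
    (isIrreducible_exceptionalPairs hr hp hm ((hN 2).trans (hN 1).symm) hb).image _
      continuous_mk.continuousOn
  -- components of `D` with a common point, and an orbit criterion for their equality
  have hcinter : ∀ b ∈ S, ∀ b' ∈ S, (c b ∩ c b').Nonempty → b' ∈ orbitClosure p 1 b := by
    rintro b hb b' hb' ⟨P, hP, hP'⟩
    obtain ⟨q, rfl⟩ := mk_surjective P
    rw [hcmem] at hP hP'
    obtain ⟨t, ht0, ht⟩ := exists_ne_zero_of_mem_divisorPairs hp hP
    refine mem_orbitClosure_of_common hp hP.2 hP'.2 (i := 1) (fin_val_one hr).ge ?_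
    rw [ht 1, update_zero_apply_of_pos b (fin_val_one hr).ge]
    exact mul_ne_zero (pow_ne_zero _ ht0) (hS0 b hb 1)
  have hceq : ∀ b ∈ S, ∀ b' ∈ S, b' ∈ orbitClosure p 1 b → c b = c b' := by
    intro b hb b' hb' h
    simp only [hc, divisorPairs, orbitClosure_eq_of_mem hp hm hr1 hb' h]
  have hceq_iff : ∀ b ∈ S, ∀ b' ∈ S, c b = c b' ↔ b' ∈ orbitClosure p 1 b := by
    intro b hb b' hb'
    refine ⟨fun h => hcinter b hb b' hb' ?_, hceq b hb b' hb'⟩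
    rw [← h, Set.inter_self]
    exact (hcirr b hb).nonempty
  -- a component of `D` meets a component of `ℰ` only if their tuples lie in the same orbit
  have hceinter : ∀ b ∈ S, ∀ b' ∈ S, (c b ∩ e b').Nonempty → b' ∈ orbitClosure p 2 b := by
    rintro b hb b' hb' ⟨P, hP, hP'⟩
    obtain ⟨q, rfl⟩ := mk_surjective P
    rw [hcmem] at hP
    rw [hemem] at hP'
    obtain ⟨t, ht0, ht⟩ := exists_ne_zero_of_mem_divisorPairs hp hP
    refine mem_orbitClosure_of_common hp (orbitClosure_mono p one_le_two b hP.2) hP'.2.1 (i := 2)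
      (fin_val_two hr).ge ?_
    rw [ht 2, update_zero_apply_of_pos b (one_le_two.trans (fin_val_two hr).ge)]
    exact mul_ne_zero (pow_ne_zero _ ht0) (hS0 b hb 2)
  have heeq : ∀ b ∈ S, ∀ b' ∈ S, b' ∈ orbitClosure p 2 b → e b = e b' := by
    intro b hb b' hb' h
    simp only [he, exceptionalPairs, orbitClosure_eq_of_mem hp hm hr hb' h]
  -- the point of the curve of `b` on the exceptional divisor
  have hpoint : ∀ b (hb : b ∈ S), mk d a p (curvePoint p hr (hS0 b hb) 0) ∈ c b ∩ e b := by
    intro b hb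
    exact ⟨⟨_, curvePoint_mem_divisorPairs hr _ 0, rfl⟩,
      ⟨_, curvePoint_zero_mem_exceptionalPairs hr hp hm hb, rfl⟩⟩
  have heeq_of_le : ∀ b ∈ S, ∀ b' ∈ S, e b ⊆ e b' → b' ∈ orbitClosure p 2 b := by
    intro b hb b' hb' h
    exact hceinter b hb b' hb' ⟨_, (hpoint b hb).1, h (hpoint b hb).2⟩
  have heeq_iff : ∀ b ∈ S, ∀ b' ∈ S, e b = e b' ↔ b' ∈ orbitClosure p 2 b := by
    intro b hb b' hb'
    exact ⟨fun h => heeq_of_le b hb b' hb' h.subset, heeq b hb b' hb'⟩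
  have hSfin : S.Finite := finite_signedTuples hm
  have hcompD : componentsOf D = c '' S := by
    refine componentsOf_eq_image (hSfin.image c) hcclosed hcirr (fun b hb b' hb' h => ?_)
      (hD.trans (strictTransform_eq_iUnion hr hp hm hN hdvd hcclosed))
    refine hceq b hb b' hb' (hcinter b hb b' hb' ?_)
    rw [Set.inter_eq_left.2 h]
    exact (hcirr b hb).nonempty
  have hcompE : componentsOf E = e '' S :=
    componentsOf_eq_image (hSfin.image e) heclosed heirr
      (fun b hb b' hb' h => heeq b hb b' hb' (heeq_of_le b hb b' hb' h))
      (hE.trans (exceptionalLocus_eq_iUnion hr hp hm hN))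
  rw [hcompD, hcompE]
  have hcard1 : (c '' S).ncard = (monomialSubgroup p m 1).index :=
    ncard_image_signedTuples hp hm hr1 hceq_iff
  have hcard2 : (e '' S).ncard = (monomialSubgroup p m 2).index :=
    ncard_image_signedTuples hp hm hr heeq_iff
  have hindex1 := index_monomialSubgroup_mul hp hm hN hr1
  have hindex2 := index_monomialSubgroup_mul hp hm hN hr
  have hrel := Subgroup.relIndex_mul_index (monomialSubgroup_mono p m one_le_two)
  have hprod : ∀ k, prodFrom m k ≠ 0 := fun k => Finset.prod_ne_zero_iff.2 fun i _ => (hm i).ne'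
  have hlcm1 : 0 < lcmFrom m 1 :=
    Nat.pos_of_ne_zero fun h => hprod 1 (by rw [← hindex1, h, mul_zero])
  have hidx2 : 0 < (monomialSubgroup p m 2).index :=
    Nat.pos_of_ne_zero fun h => hprod 2 (by rw [← hindex2, h, zero_mul])
  have hrelcard : m 1 * lcmFrom m 2 / lcmFrom m 1 =
      (monomialSubgroup p m 1).relIndex (monomialSubgroup p m 2) := by
    refine Nat.div_eq_of_eq_mul_left hlcm1 (Nat.eq_of_mul_eq_mul_left hidx2 ?_)
    rw [mul_left_comm, hindex2, ← prodFrom_one m hr, ← hindex1, ← hrel]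
    ring
  refine ⟨⟨?_, ?_⟩, ?_, ?_, ?_⟩
  · rw [← (hSfin.image c).cast_ncard_eq, hcard1, Nat.div_eq_of_eq_mul_left hlcm1 hindex1.symm]
  · rintro _ ⟨b, hb, rfl⟩ _ ⟨b', hb', rfl⟩ hne
    rw [Function.onFun, id, id, Set.disjoint_iff_inter_eq_empty, ← Set.not_nonempty_iff_eq_empty]
    exact fun h => hne (hceq b hb b' hb' (hcinter b hb b' hb' h))
  · rintro _ ⟨b, hb, rfl⟩
    refine ⟨e b, ⟨b, hb, rfl⟩, ⟨_, Set.eq_singleton_iff_unique_mem.2 ⟨hpoint b hb, ?_⟩⟩, ?_⟩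
    · rintro P ⟨hP, hP'⟩
      obtain ⟨q, rfl⟩ := mk_surjective P
      rw [hcmem] at hP
      rw [hemem] at hP'
      obtain ⟨s, hs, hs0⟩ := mk_eq_mk_curvePoint (d := d) (a := a) hr hp (hS0 b hb) hP
      rw [← hs, hs0 hP'.1]
    · rintro _ ⟨b', hb', rfl⟩ h
      exact (heeq b hb b' hb' (hceinter b hb b' hb' h)).symm
  · rintro _ ⟨b, hb, rfl⟩
    have hset : {C ∈ c '' S | (C ∩ e b).Nonempty} = c '' {b' ∈ S | b' ∈ orbitClosure p 2 b} := by
      ext C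
      constructor
      · rintro ⟨⟨b', hb', rfl⟩, h⟩
        refine ⟨b', ⟨hb', ?_⟩, rfl⟩
        rw [← orbitClosure_eq_of_mem hp hm hr hb (hceinter b' hb' b hb h)]
        exact self_mem_orbitClosure p 2 b'
      · rintro ⟨b', ⟨hb', h⟩, rfl⟩
        refine ⟨⟨b', hb', rfl⟩, _, (hpoint b' hb').1, ?_⟩
        rw [heeq b hb b' hb' h]
        exact (hpoint b' hb').2
    rw [hset, ← ((hSfin.subset (Set.sep_subset _ _)).image c).cast_ncard_eq,
      ncard_image_fiber hp hm hr1 hr hceq_iff hb, hrelcard]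
  · rw [hrelcard, hcard1, hcard2, ← hrel, Nat.cast_mul, mul_div_cancel_right₀]
    exact_mod_cast hidx2.ne'

end
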